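/- Let $\mathcal X,\mathcal Y$ be finite sets, let $f:\mathcal X\times\mathcal Y\to\mathcal Z$ be a function, let $k\ge 1$ be an integer, and let $\delta,\epsilon>0$ be real numbers. Let $\mu$ be a product distribution on $\mathcal X\times\mathcal Y$, i.e. $\mu(x,y)=\mu_{\mathcal X}(x)\,\mu_{\mathcal Y}(y)$ for some probability distributions $\mu_{\mathcal X}$ on $\mathcal X$ and $\mu_{\mathcal Y}$ on $\mathcal Y$. Then $$\mathrm{IC}^{k}_{\mu,\delta}(f)\;\ge\;\frac{\epsilon^2}{2k}\cdot C^{k}_{\mu,\delta+2\epsilon}(f)\;-\;2 .$$ Here Alice holds $x\in\mathcal X$ and Bob holds $y\in\mathcal Y$. In a $k$-round protocol the two players alternately send $k$ messages in total, which are (possibly empty) bit strings; a fixed one of the two players (either one, the same for both sides of the inequality) sends the first message, and the receiver of the last message announces an answer in $\mathcal Z$. After any given sequence of messages, the possible next messages form a prefix-free set. In a deterministic protocol each message, and the answer, is a function of the player's own input and of the messages exchanged so far; in a private-coin protocol it may depend also on the player's own random coin, where each coin has finite range and the two coins are independent of each other and of the inputs. The transcript is the sequence of all $k$ messages. $C^{k}_{\mu,\eta}(f)$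 is the minimum, over all $k$-round deterministic protocols whose answer equals $f(x,y)$ with probability at least $1-\eta$ when $(x,y)$ is drawn from $\mu$, of the communication cost, i.e. of the maximum over all inputs of the total number of bits sent. $\mathrm{IC}^{k}_{\mu,\delta}(f)$ is the infimum, over all $k$-round private-coin protocols whose answer equals $f(x,y)$ with probability at least $1-\delta$ over the coins for every input $(x,y)$, of the information cost $I(XY:T)=H(XY)+H(T)-H(XYT)$, where $(X,Y)$ is distributed according to $\mu$, $T$ is the transcript on input $(X,Y)$, and $H$ is the Shannon entropy with logarithms to base $2$. -/

import Mathlib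

namespace CommComplexity

universe u v w

/-! ### Information theory (logarithms to base 2) -/

/-- Shannon entropy, in bits, of a probability distribution. It is only ever applied to
distributions of finite support, so the sum is a finite one; the convention `0 log 0 = 0` is
built in, since `Real.logb 2 0 = 0`. -/
noncomputable def entropy {α : Type*} (p : PMF α) : ℝ :=
  -∑' a, (p a).toReal * Real.logb 2 (p a).toReal

/-- Mutual information `I(A : B) = H(A) + H(B) - H(AB)` of a pair with the given joint law. -/
noncomputable def mutualInfo {α β : Type*} (joint : PMF (α × β)) : ℝ :=
  entropy (joint.map Prod.fst) + entropy (joint.map Prod.snd) - entropy joint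

/-- `μ` is a product distribution: `μ(x, y) = μ_X(x) μ_Y(y)`. -/
def IsProduct {X : Type u} {Y : Type v} (μ : PMF (X × Y)) : Prop :=
  ∃ (μX : PMF X) (μY : PMF Y), ∀ x y, μ (x, y) = μX x * μY y

/-! ### Protocols -/

/-- The two players. -/
inductive Player where
  | alice
  | bob

/-- The opponent of a player. -/
def Player.other : Player → Player
  | .alice => .bob
  | .bob => .alice

/-- The players alternate, `first` sending message number `0`: the sender of message `i`. -/
def speaker (first : Player) : ℕ → Player
  | 0 => first
  | i + 1 => (speaker first i).other

/-- A transcript: the list of the messages (bit strings) exchanged so far, in order. -/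
abbrev Transcript : Type := List (List Bool)

/-- What one player does, as a function of the private input in `I` and of the transcript so far:
the next message, and the answer (used only if the player has to give it). After every transcript
the messages that the player may send form a prefix-free set, so that the receiver can tell where
a message ends. (The empty message alone is a prefix-free set.) -/
structure Strategy (I : Type u) (Z : Type w) where
  /-- the next message -/
  msg : I → Transcript → List Bool
  /-- the answer at the end -/
  answer : I → Transcript → Z
  /-- the possible next messages are prefix-free -/
  prefixFree : ∀ (h : Transcript) (a b : I), msg a h <+: msg b h → msg a h = msg b h

/-- A deterministic two-party protocol. -/
structure DetProtocol (X : Type u) (Y : Type v) (Z : Type w) where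
  /-- Alice's part -/
  alice : Strategy X Z
  /-- Bob's part -/
  bob : Strategy Y Z

namespace DetProtocol

variable {X : Type u} {Y : Type v} {Z : Type w}

/-- The transcript of the first `i` messages on input `(x, y)`, when `first` begins. -/
def transcript (P : DetProtocol X Y Z) (first : Player) (x : X) (y : Y) : ℕ → Transcript
  | 0 => []
  | i + 1 =>
    P.transcript first x y i ++
      [match speaker first i with
        | .alice => P.alice.msg x (P.transcript first x y i)
        | .bob => P.bob.msg y (P.transcript first x y i)]

/-- The answer after `k` messages. It is given by the player who would have to speak next, which
for `k ≥ 1` is the receiver of the last message. -/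
def output (P : DetProtocol X Y Z) (first : Player) (k : ℕ) (x : X) (y : Y) : Z :=
  match speaker first k with
  | .alice => P.alice.answer x (P.transcript first x y k)
  | .bob => P.bob.answer y (P.transcript first x y k)

/-- Communication cost with `k` messages: the maximal total number of bits over all inputs. -/
def cost [Fintype X] [Fintype Y] (P : DetProtocol X Y Z) (first : Player) (k : ℕ) : ℕ :=
  Finset.univ.sup fun p : X × Y => (P.transcript first p.1 p.2 k).flatten.length

open Classical in
/-- The probability that the `k`-message protocol computes `f` correctly on a `μ`-random input. -/
noncomputable def successProb [Fintype X] [Fintype Y] (P : DetProtocol X Y Z) (first : Player)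
    (k : ℕ) (μ : PMF (X × Y)) (f : X → Y → Z) : ℝ :=
  ∑ p : X × Y, if P.output first k p.1 p.2 = f p.1 p.2 then (μ p).toReal else 0

end DetProtocol

/-- A private-coin randomised protocol: Alice and Bob each hold, besides their input, the outcome
of a private random coin of finite range (any distribution is allowed); the two coins are
independent of each other and of the inputs. For fixed coins the protocol is a deterministic
protocol in which each player knows his or her own input and coin only. -/
structure PrivateCoinProtocol (X : Type u) (Y : Type v) (Z : Type w) where
  /-- number of outcomes of Alice's coin -/
  nA : ℕ
  /-- number of outcomes of Bob's coin -/
  nB : ℕ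
  /-- distribution of Alice's coin -/
  coinA : PMF (Fin nA)
  /-- distribution of Bob's coin -/
  coinB : PMF (Fin nB)
  /-- the protocol, each coin being treated as a part of the input of its owner -/
  det : DetProtocol (X × Fin nA) (Y × Fin nB) Z

namespace PrivateCoinProtocol

variable {X : Type u} {Y : Type v} {Z : Type w}

/-- Distribution of the transcript of all `k` messages on input `(x, y)`. -/
noncomputable def transcriptLaw (P : PrivateCoinProtocol X Y Z) (first : Player) (k : ℕ)
    (x : X) (y : Y) : PMF Transcript :=
  P.coinA.bind fun r => P.coinB.bind fun s => PMF.pure (P.det.transcript first (x, r) (y, s) k)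

/-- Distribution of the answer after `k` messages on input `(x, y)`. -/
noncomputable def outputLaw (P : PrivateCoinProtocol X Y Z) (first : Player) (k : ℕ)
    (x : X) (y : Y) : PMF Z :=
  P.coinA.bind fun r => P.coinB.bind fun s => PMF.pure (P.det.output first k (x, r) (y, s))

/-- `P` is a `δ`-error protocol for `f`: on *every* input the answer is correct with probability
at least `1 - δ`. -/
def IsErrorProtocol (P : PrivateCoinProtocol X Y Z) (first : Player) (k : ℕ) (δ : ℝ)
    (f : X → Y → Z) : Prop :=
  ∀ x y, 1 - δ ≤ (P.outputLaw first k x y (f x y)).toReal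

/-- Joint law of the input pair `(X, Y)`, distributed according to `μ`, and the transcript. -/
noncomputable def jointLaw (P : PrivateCoinProtocol X Y Z) (first : Player) (k : ℕ)
    (μ : PMF (X × Y)) : PMF ((X × Y) × Transcript) :=
  μ.bind fun p => (P.transcriptLaw first k p.1 p.2).map fun t => (p, t)

/-- The information cost `I(XY : T)` of the `k`-message protocol under `μ`. -/
noncomputable def infoCost (P : PrivateCoinProtocol X Y Z) (first : Player) (k : ℕ)
    (μ : PMF (X × Y)) : ℝ :=
  mutualInfo (P.jointLaw first k μ)

end PrivateCoinProtocol

/-! ### Complexity measures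

Both are infima in the extended reals; an infimum over no protocol at all is `⊤`. -/

/-- `IC^k_{μ,δ}(f)`: the infimum of the information cost under `μ` of the `k`-round `δ`-error
private-coin protocols for `f` (with `first` sending the first message). -/
noncomputable def infoComplexity {X : Type u} {Y : Type v} {Z : Type w}
    (first : Player) (k : ℕ) (μ : PMF (X × Y)) (δ : ℝ) (f : X → Y → Z) : EReal :=
  ⨅ (P : PrivateCoinProtocol X Y Z) (_ : P.IsErrorProtocol first k δ f),
    ((P.infoCost first k μ : ℝ) : EReal)

/-- `C^k_{μ,δ}(f)`: the least communication cost of a `k`-round deterministic protocol for `f`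
with distributional error at most `δ` under `μ` (with `first` sending the first message). -/
noncomputable def distComplexity {X : Type u} {Y : Type v} {Z : Type w} [Fintype X] [Fintype Y]
    (first : Player) (k : ℕ) (μ : PMF (X × Y)) (δ : ℝ) (f : X → Y → Z) : EReal :=
  ⨅ (P : DetProtocol X Y Z) (_ : 1 - δ ≤ P.successProb first k μ f),
    ((P.cost first k : ℕ) : EReal)

end CommComplexity

/-! Given the transcript so far, the private states of the players (input and coin) stay
independent, since `μ` is a product. The information cost `I` is the expected logarithm of the
ratio between the likelihoods of the transcript for known and for unknown inputs, and this
logarithm is a sum of one term per message. A message is compressed by rejection sampling from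
shared samples of its law as seen by its receiver: sending the position of the accepted sample
takes, in expectation, at most 15 bits more than 4 times the expected log-ratio of that message.
Put `C = (4 * I + 15 * k) / (2 * ε)` and charge `C` for a wrong answer: averaging over the shared
samples gives a deterministic protocol whose expected loss is at most `C * (δ + 2 * ε)`. Cut off
after `C` bits, it errs only where the loss was at least `C`, hence with probability at most
`δ + 2 * ε`. If `ε > 1 / 2` then every error is allowed, so that nothing need be sent. -/

namespace CommComplexity

universe u v w

section Averages

variable {ι A : Type*} [Fintype ι] [Fintype A]

theorem exists_pos_weight_le_sum {p : ι → ℝ} (hp : p ∈ stdSimplex ℝ ι) (F : ι → ℝ) :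
    ∃ i, 0 < p i ∧ F i ≤ ∑ j, p j * F j := by
  classical
  set m := ∑ j, p j * F j with hm
  have hsum : ∑ i with 0 < p i, p i = 1 := by
    rw [← hp.2, Finset.sum_filter_of_ne fun i _ h => (hp.1 i).lt_of_ne' h]
  have hmean : ∑ i with 0 < p i, p i * F i = ∑ i with 0 < p i, p i * m := by
    rw [← Finset.sum_mul, hsum, one_mul, hm, Finset.sum_filter_of_ne]
    exact fun i _ h => (hp.1 i).lt_of_ne' (left_ne_zero_of_mul h)
  have hne : (Finset.univ.filter fun i => 0 < p i).Nonempty :=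
    Finset.nonempty_of_sum_ne_zero (hsum ▸ one_ne_zero)
  obtain ⟨i, hi, hle⟩ := Finset.exists_le_of_sum_le hne hmean.le
  have hpos : 0 < p i := (Finset.mem_filter.1 hi).2
  exact ⟨i, hpos, le_of_mul_le_mul_left hle hpos⟩

/-- The expectation of a function of `n` independent samples from the distribution `Q`, the
samples being presented as a list. -/
noncomputable def iidMean (Q : A → ℝ) : ℕ → (List A → ℝ) →ₗ[ℝ] ℝ
  | 0 => LinearMap.proj []
  | n + 1 => ∑ a, Q a • iidMean Q n ∘ₗ LinearMap.funLeft ℝ ℝ (List.cons a)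

variable {Q : A → ℝ}

@[simp] theorem iidMean_zero (F : List A → ℝ) : iidMean Q 0 F = F [] := rfl

theorem iidMean_succ (n : ℕ) (F : List A → ℝ) :
    iidMean Q (n + 1) F = ∑ a, Q a * iidMean Q n fun l => F (a :: l) := by
  simp [iidMean, LinearMap.funLeft, Function.comp_def]

theorem iidMean_const (hQ : Q ∈ stdSimplex ℝ A) (n : ℕ) (r : ℝ) :
    iidMean Q n (fun _ => r) = r := by
  induction n with
  | zero => rfl
  | succ n ih => simp only [iidMean_succ, ih, ← Finset.sum_mul, hQ.2, one_mul]

theorem iidMean_mono (hQ : ∀ a, 0 ≤ Q a) (n : ℕ) {F G : List A → ℝ} (h : ∀ l, F l ≤ G l) :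
    iidMean Q n F ≤ iidMean Q n G := by
  induction n generalizing F G with
  | zero => exact h []
  | succ n ih =>
    simp only [iidMean_succ]
    exact Finset.sum_le_sum fun a _ => mul_le_mul_of_nonneg_left (ih fun l => h _) (hQ a)

theorem exists_le_iidMean (hQ : Q ∈ stdSimplex ℝ A) (n : ℕ) (F : List A → ℝ) :
    ∃ l, F l ≤ iidMean Q n F := by
  induction n generalizing F with
  | zero => exact ⟨[], le_rfl⟩
  | succ n ih =>
    obtain ⟨a, -, ha⟩ := exists_pos_weight_le_sum hQ fun a => iidMean Q n fun l => F (a :: l)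
    obtain ⟨l, hl⟩ := ih fun l => F (a :: l)
    exact ⟨a :: l, hl.trans (ha.trans_eq (iidMean_succ n F).symm)⟩

end Averages

section NatCode

/-- A prefix-free binary code for the natural numbers: the number of digits in unary, followed by
the digits. -/
def natCode (n : ℕ) : List Bool :=
  List.replicate n.size true ++ false :: n.bits

theorem length_natCode (n : ℕ) : (natCode n).length = 2 * n.size + 1 := by
  simp only [natCode, List.length_append, List.length_replicate, List.length_cons,
    Nat.size_eq_bits_len]
  omega

theorem replicate_true_prefix {m n : ℕ} {l l' : List Bool}
    (h : List.replicate m true ++ false :: l <+: List.replicate n true ++ false :: l') :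
    m = n ∧ l <+: l' := by
  induction m generalizing n with
  | zero =>
    cases n with
    | zero => simpa using h
    | succ n => simp [List.replicate_succ] at h
  | succ m ih =>
    cases n with
    | zero => simp [List.replicate_succ] at h
    | succ n =>
      simp only [List.replicate_succ, List.cons_append, List.cons_prefix_cons, true_and] at h
      exact ⟨congrArg _ (ih h).1, (ih h).2⟩

theorem natCode_prefix {m n : ℕ} (h : natCode m <+: natCode n) : m = n := by
  obtain ⟨hsize, hpre⟩ := replicate_true_prefix h
  have hbits : m.bits = n.bits :=
    hpre.eq_of_length (by rw [Nat.size_eq_bits_len, Nat.size_eq_bits_len, hsize])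
  exact Nat.digits.injective 2 (by rw [Nat.digits_two_eq_bits, Nat.digits_two_eq_bits, hbits])

theorem natCode_injective : Function.Injective natCode :=
  fun _ _ h => natCode_prefix (h ▸ List.prefix_rfl)

theorem size_le_add_div_two_pow (n t : ℕ) : (n.size : ℝ) ≤ t + n / 2 ^ t := by
  rcases le_or_gt n.size t with h | h
  · exact le_add_of_le_of_nonneg (mod_cast h) (by positivity)
  · obtain ⟨u, hu⟩ : ∃ u, n.size = t + u + 1 := ⟨n.size - t - 1, by omega⟩
    have hdigits : 2 ^ (t + u) ≤ n := Nat.lt_size.1 (by omega)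
    have hexcess : ((u + 1 : ℕ) : ℝ) ≤ n / 2 ^ t := by
      rw [le_div_iff₀ (by positivity)]
      have hu_le : u + 1 ≤ 2 ^ u := Nat.lt_two_pow_self
      exact_mod_cast calc (u + 1) * 2 ^ t ≤ 2 ^ u * 2 ^ t := Nat.mul_le_mul_right _ hu_le
        _ = 2 ^ (t + u) := by rw [pow_add, mul_comm]
        _ ≤ n := hdigits
    rw [hu, add_assoc]
    push_cast at hexcess ⊢
    linarith

theorem size_floor_le {ρ : ℝ} (hρ : 0 < ρ) :
    (Nat.size ⌊ρ⌋₊ : ℝ) ≤ Real.logb 2 ρ + 1 + ρ⁻¹ := by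
  have hρ' : 0 < ρ⁻¹ := inv_pos.2 hρ
  rcases lt_or_ge ρ 1 with h | h
  · have hlog2 : 0 < Real.log 2 := Real.log_pos one_lt_two
    have hlog : 1 - (2 * ρ)⁻¹ ≤ Real.log 2 + Real.log ρ := by
      rw [← Real.log_mul two_ne_zero hρ.ne']
      exact Real.one_sub_inv_le_log_of_pos (by positivity)
    have hsum : 0 ≤ Real.log ρ + (1 + ρ⁻¹) * Real.log 2 := by
      rw [mul_inv] at hlog
      nlinarith [Real.log_two_gt_d9]
    rw [Nat.floor_eq_zero.2 h, Nat.size_zero, Nat.cast_zero, Real.logb, add_assoc,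
      ← mul_div_cancel_right₀ (1 + ρ⁻¹) hlog2.ne', ← add_div]
    exact div_nonneg hsum hlog2.le
  · obtain ⟨m, hm⟩ : ∃ m, Nat.size ⌊ρ⌋₊ = m + 1 := by
      refine Nat.exists_eq_succ_of_ne_zero fun h0 => ?_
      rw [Nat.size_eq_zero, Nat.floor_eq_zero] at h0
      exact h.not_gt h0
    have hpow : (2 : ℝ) ^ m ≤ ρ :=
      le_trans (mod_cast Nat.lt_size.1 (hm ▸ m.lt_succ_self)) (Nat.floor_le hρ.le)
    have hlogb : (m : ℝ) ≤ Real.logb 2 ρ := by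
      rwa [Real.le_logb_iff_rpow_le one_lt_two hρ, Real.rpow_natCast]
    rw [hm, Nat.cast_succ]
    linarith

end NatCode

section Fibers

variable {ι γ : Type*} [DecidableEq γ]

/-- The part of the weights `α` that lies on the fiber of `g` over `c`. -/
def onFiber (g : ι → γ) (c : γ) (α : ι → ℝ) (i : ι) : ℝ := if g i = c then α i else 0

theorem onFiber_nonneg (g : ι → γ) (c : γ) {α : ι → ℝ} (hα : ∀ i, 0 ≤ α i) (i : ι) :
    0 ≤ onFiber g c α i := by
  rw [onFiber]
  split_ifs
  exacts [hα i, le_rfl]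

variable [Fintype ι]

theorem sum_range_sum_onFiber_mul (g : ι → γ) (α : ι → ℝ) (F : γ → ι → ℝ) :
    ∑ c : Set.range g, ∑ i, onFiber g c α i * F c i = ∑ i, α i * F (g i) i := by
  rw [Finset.sum_comm]
  refine Finset.sum_congr rfl fun i _ => ?_
  rw [Finset.sum_eq_single (⟨g i, i, rfl⟩ : Set.range g)]
  · rw [onFiber, if_pos rfl]
  · exact fun c _ hc => by rw [onFiber, if_neg fun h => hc (Subtype.ext h.symm), zero_mul]
  · exact fun h => absurd (Finset.mem_univ _) h

theorem sum_range_sum_onFiber (g : ι → γ) (α : ι → ℝ) :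
    ∑ c : Set.range g, ∑ i, onFiber g c α i = ∑ i, α i := by
  simpa only [mul_one] using sum_range_sum_onFiber_mul g α fun _ _ => 1

theorem sum_sum_onFiber_mul [Fintype γ] (g : ι → γ) (α : ι → ℝ) (F : γ → ι → ℝ) :
    ∑ c, ∑ i, onFiber g c α i * F c i = ∑ i, α i * F (g i) i := by
  rw [Finset.sum_comm]
  simp only [onFiber, ite_mul, zero_mul, Finset.sum_ite_eq, Finset.mem_univ, if_true]

theorem sum_mul_comp_eq_sum_range (g : ι → γ) (α : ι → ℝ) (φ : γ → ℝ) :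
    ∑ i, α i * φ (g i) = ∑ c : Set.range g, (∑ i, onFiber g c α i) * φ c := by
  simp only [Finset.sum_mul, sum_range_sum_onFiber_mul g α fun c _ => φ c]

theorem onFiber_eq_zero_of_sum_eq_zero {g : ι → γ} {c : γ} {α : ι → ℝ} (hα : ∀ i, 0 ≤ α i)
    (h : ∑ i, onFiber g c α i = 0) (i : ι) : onFiber g c α i = 0 :=
  (Finset.sum_eq_zero_iff_of_nonneg fun i _ => onFiber_nonneg g c hα i).1 h i (Finset.mem_univ i)

theorem sum_mul_fiber_mean (g : ι → γ) {α : ι → ℝ} (hα : ∀ i, 0 ≤ α i) (F : ι → ℝ) :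
    ∑ i, α i * ((∑ j, onFiber g (g i) α j * F j) / ∑ j, onFiber g (g i) α j) =
      ∑ i, α i * F i := by
  rw [sum_mul_comp_eq_sum_range g α fun c =>
      (∑ j, onFiber g c α j * F j) / ∑ j, onFiber g c α j,
    ← sum_range_sum_onFiber_mul g α fun _ i => F i]
  refine Finset.sum_congr rfl fun c _ => mul_div_cancel_of_imp' fun h => ?_
  exact Finset.sum_eq_zero fun i _ => by rw [onFiber_eq_zero_of_sum_eq_zero hα h, zero_mul]

theorem sum_mul_div_fiber_mass_le (g : ι → γ) (α : ι → ℝ) {h : γ → ℝ} (hh : ∀ c, 0 ≤ h c) :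
    ∑ i, α i * (h (g i) / ∑ j, onFiber g (g i) α j) ≤ ∑ c : Set.range g, h c := by
  rw [sum_mul_comp_eq_sum_range g α fun c => h c / ∑ j, onFiber g c α j]
  refine Finset.sum_le_sum fun c _ => ?_
  rw [mul_div_left_comm]
  exact mul_le_of_le_one_right (hh c) (div_self_le_one _)

end Fibers

section RejectionSampling

variable {A : Type*} [Fintype A]

/-- The shared samples `l`, followed by all symbols, so that a search for a prescribed symbol
always succeeds. -/
noncomputable def pool (l : List A) : List A := l ++ Finset.univ.toList

/-- The expected cost of rejection sampling from the samples in a list, where examining a sample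
costs `c`, the sample `a` is accepted with probability `acc a` at the additional cost `G a`, and
running out of samples costs `W`. -/
def rejectionCost (acc : A → ℝ) (c : ℝ) (G : A → ℝ) (W : ℝ) : List A → ℝ
  | [] => W
  | a :: l => c + acc a * G a + (1 - acc a) * rejectionCost acc c G W l

theorem exists_pool_cost_le {T acc : A → ℝ} (hT : T ∈ stdSimplex ℝ A) (hacc₀ : ∀ a, 0 ≤ acc a)
    (hacc₁ : ∀ a, acc a ≤ 1) (hacc : ∀ a, T a = 0 → acc a = 0) {c : ℝ} (hc : 0 ≤ c) (G : A → ℝ)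
    (l : List A) :
    ∃ (i : ℕ) (a : A), (pool l)[i]? = some a ∧ 0 < T a ∧ c * (i + 1) + G a ≤
      rejectionCost acc c G (c * Fintype.card A + ∑ b, T b * G b) l := by
  induction l with
  | nil =>
    obtain ⟨a, ha, hGa⟩ := exists_pos_weight_le_sum hT G
    obtain ⟨i, hi, hia⟩ := List.getElem_of_mem (Finset.mem_toList.2 (Finset.mem_univ a))
    have hcard : ((i : ℝ) + 1) ≤ Fintype.card A := by
      rw [Finset.length_toList, Finset.card_univ] at hi
      exact_mod_cast hi
    exact ⟨i, a, List.getElem?_eq_some_iff.2 ⟨hi, hia⟩, ha,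
      add_le_add (mul_le_mul_of_nonneg_left hcard hc) hGa⟩
  | cons b l ih =>
    obtain ⟨i, a, hia, ha, hle⟩ := ih
    rw [rejectionCost]
    set R := rejectionCost acc c G (c * Fintype.card A + ∑ b, T b * G b) l
    by_cases hb : acc b * (G b - R) < 0
    · have hTb : 0 < T b := (hT.1 b).lt_of_ne' fun h => by simp [hacc b h] at hb
      refine ⟨0, b, rfl, hTb, ?_⟩
      have hGb : G b - R < 0 := neg_of_mul_neg_right hb (hacc₀ b)
      rw [Nat.cast_zero, zero_add, mul_one]
      linarith [mul_nonpos_of_nonneg_of_nonpos (sub_nonneg.2 (hacc₁ b)) hGb.le]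
    · refine ⟨i + 1, a, hia, ha, ?_⟩
      push_cast
      linarith

theorem one_sub_pow_mul_one_add_le {q : ℝ} (h0 : 0 ≤ q) (h1 : q ≤ 1) (n : ℕ) :
    (1 - q) ^ n * (1 + n * q) ≤ 1 :=
  calc (1 - q) ^ n * (1 + n * q) ≤ (1 - q) ^ n * (1 + q) ^ n :=
        mul_le_mul_of_nonneg_left (one_add_mul_le_pow (by linarith) n)
          (pow_nonneg (sub_nonneg.2 h1) n)
    _ = (1 - q ^ 2) ^ n := by rw [← mul_pow]; ring
    _ ≤ 1 := pow_le_one₀ (by nlinarith) (by nlinarith)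

theorem iidMean_rejectionCost {Q acc G : A → ℝ} (hQ : Q ∈ stdSimplex ℝ A) {q M : ℝ}
    (hacc : ∑ a, Q a * acc a = q) (hG : ∑ a, Q a * (acc a * G a) = q * M) {c L : ℝ}
    (hL : q * L = 1) (W : ℝ) (n : ℕ) :
    iidMean Q n (rejectionCost acc c G W) = c * L + M + (1 - q) ^ n * (W - (c * L + M)) := by
  induction n with
  | zero => rw [iidMean_zero, rejectionCost]; ring
  | succ n ih =>
    have hstep (a : A) : (iidMean Q n fun l => rejectionCost acc c G W (a :: l)) =
        c + acc a * G a + (1 - acc a) * iidMean Q n (rejectionCost acc c G W) := by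
      have hfun : (fun l => rejectionCost acc c G W (a :: l)) =
          (fun _ => c + acc a * G a) + (1 - acc a) • rejectionCost acc c G W := rfl
      rw [hfun, map_add, map_smul, iidMean_const hQ, smul_eq_mul]
    have hmean : ∑ a, Q a * (c + acc a * G a + (1 - acc a) *
        iidMean Q n (rejectionCost acc c G W)) =
        c + q * M + (1 - q) * iidMean Q n (rejectionCost acc c G W) := by
      simp only [mul_add, Finset.sum_add_distrib, sub_mul, one_mul, mul_sub,
        Finset.sum_sub_distrib, hG, ← Finset.sum_mul, hQ.2]
      simp only [← mul_assoc, ← Finset.sum_mul, hacc]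
    rw [iidMean_succ]
    simp only [hstep]
    rw [hmean, ih, pow_succ]
    linear_combination -c * hL

theorem exists_rejection_sampler {T Q : A → ℝ} (hT : T ∈ stdSimplex ℝ A)
    (hQ : Q ∈ stdSimplex ℝ A) {L : ℝ} (hTQ : ∀ a, T a ≤ L * Q a) {c : ℝ} (hc : 0 ≤ c)
    (G : A → ℝ) :
    ∃ (pos : List A → ℕ) (sym : List A → A), (∀ l, (pool l)[pos l]? = some (sym l)) ∧
      (∀ l, 0 < T (sym l)) ∧
      iidMean Q (Fintype.card A) (fun l => c * (pos l + 1) + G (sym l)) ≤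
        2 * c * L + ∑ a, T a * G a := by
  have hL : 1 ≤ L := by
    rw [← hT.2, ← mul_one L, ← hQ.2, Finset.mul_sum]
    exact Finset.sum_le_sum fun a _ => hTQ a
  have hL₀ : 0 < L := one_pos.trans_le hL
  set acc : A → ℝ := fun a => T a / (L * Q a) with hacc
  have hQacc (a : A) : Q a * acc a = L⁻¹ * T a := by
    rcases eq_or_ne (Q a) 0 with h | h
    · have hTa : T a = 0 := le_antisymm (by simpa [h] using hTQ a) (hT.1 a)
      rw [h, hTa, zero_mul, mul_zero]
    · rw [hacc]; field_simp
  choose pos sym hpool hsym hcost using exists_pool_cost_le (acc := acc) hT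
    (fun a => div_nonneg (hT.1 a) (mul_nonneg hL₀.le (hQ.1 a)))
    (fun a => div_le_one_of_le₀ (hTQ a) (mul_nonneg hL₀.le (hQ.1 a)))
    (fun a h => by simp only [hacc, h, zero_div]) hc G
  refine ⟨pos, sym, hpool, hsym, (iidMean_mono hQ.1 _ hcost).trans ?_⟩
  have hq₁ : L⁻¹ ≤ 1 := inv_le_one_of_one_le₀ hL
  rw [iidMean_rejectionCost hQ (q := L⁻¹) (M := ∑ a, T a * G a) (L := L)
    (by simp only [hQacc, ← Finset.mul_sum, hT.2, mul_one])
    (by simp only [← mul_assoc, hQacc, Finset.mul_sum]) (inv_mul_cancel₀ hL₀.ne')]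
  have htail := one_sub_pow_mul_one_add_le (inv_nonneg.2 hL₀.le) hq₁ (Fintype.card A)
  set r := (1 - L⁻¹) ^ Fintype.card A
  have hr : 0 ≤ r := pow_nonneg (sub_nonneg.2 hq₁) _
  have hrL : r * Fintype.card A ≤ L :=
    calc r * Fintype.card A = r * (Fintype.card A * L⁻¹) * L := by field_simp
      _ ≤ 1 * L := mul_le_mul_of_nonneg_right (by linarith) hL₀.le
      _ = L := one_mul L
  linarith [mul_le_mul_of_nonneg_left hrL hc, mul_nonneg (mul_nonneg hc hr) hL₀.le]

/-- The number of binary digits of the likelihood ratio `P a / Q a`, rounded down. -/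
noncomputable def ratioLevel (P Q : A → ℝ) (a : A) : ℕ := Nat.size ⌊P a / Q a⌋₊

omit [Fintype A] in
theorem le_two_pow_ratioLevel_mul {P Q : A → ℝ} {a : A} (hQ : 0 ≤ Q a)
    (hPQ : Q a = 0 → P a = 0) : P a ≤ 2 ^ ratioLevel P Q a * Q a := by
  rcases hQ.eq_or_lt' with h | h
  · rw [h, hPQ h, mul_zero]
  · rw [← div_le_iff₀ h]
    exact (Nat.lt_of_floor_lt (Nat.lt_size_self _)).le.trans_eq (mod_cast rfl)

theorem sum_mul_ratioLevel_le {P Q : A → ℝ} (hP : P ∈ stdSimplex ℝ A) (hQ : Q ∈ stdSimplex ℝ A)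
    (hPQ : ∀ a, Q a = 0 → P a = 0) :
    ∑ a, P a * ratioLevel P Q a ≤ ∑ a, P a * Real.logb 2 (P a / Q a) + 2 :=
  calc ∑ a, P a * (ratioLevel P Q a : ℝ)
      ≤ ∑ a, (P a * Real.logb 2 (P a / Q a) + P a + Q a) := by
        refine Finset.sum_le_sum fun a _ => ?_
        rcases (hP.1 a).eq_or_lt' with h | h
        · simpa [h] using hQ.1 a
        · have hQa : 0 < Q a := (hQ.1 a).lt_of_ne' fun h0 => h.ne' (hPQ a h0)
          refine (mul_le_mul_of_nonneg_left (size_floor_le (div_pos h hQa)) h.le).trans_eq ?_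
          rw [inv_div, mul_add, mul_add, mul_one, mul_div_cancel₀ _ h.ne']
    _ = ∑ a, P a * Real.logb 2 (P a / Q a) + 2 := by
        rw [Finset.sum_add_distrib, Finset.sum_add_distrib, hP.2, hQ.2]
        ring

theorem length_natCode_le (n s : ℕ) :
    ((natCode n).length : ℝ) ≤ 4 * s + 3 + (n + 1) / 4 ^ s := by
  have htangent : (n.size : ℝ) ≤ 2 * s + 1 + n / 4 ^ s / 2 := by
    have := size_le_add_div_two_pow n (2 * s + 1)
    rw [pow_succ, pow_mul, ← div_div] at this
    norm_num at this
    exact this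
  have hmono : (n : ℝ) / 4 ^ s ≤ (n + 1) / 4 ^ s := by gcongr; linarith
  rw [length_natCode]
  push_cast
  linarith

theorem exists_level_sampler {P Q : A → ℝ} (hP : ∀ a, 0 ≤ P a) (hQ : Q ∈ stdSimplex ℝ A)
    (hPQ : ∀ a, Q a = 0 → P a = 0) {v : ℝ} (hv : 0 ≤ v) (G : A → ℝ) {s : ℕ}
    (hs : 0 < ∑ a, onFiber (ratioLevel P Q) s P a) :
    ∃ (pos : List A → ℕ) (sym : List A → A), (∀ l, (pool l)[pos l]? = some (sym l)) ∧
      (∀ l, 0 < P (sym l)) ∧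
      iidMean Q (Fintype.card A) (fun l => v * (natCode (pos l)).length + G (sym l)) ≤
        v * (4 * s + 3) + 2 * v * ((1 / 2) ^ s / ∑ a, onFiber (ratioLevel P Q) s P a) +
          (∑ a, onFiber (ratioLevel P Q) s P a * G a) /
            ∑ a, onFiber (ratioLevel P Q) s P a := by
  set m := ∑ a, onFiber (ratioLevel P Q) s P a with hm
  obtain ⟨pos, sym, hpool, hsym, hmean⟩ := exists_rejection_sampler
    (T := fun a => onFiber (ratioLevel P Q) s P a / m) (L := 2 ^ s / m) (c := v / 4 ^ s)
    ⟨fun a => div_nonneg (onFiber_nonneg _ _ hP a) hs.le,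
      by rw [← Finset.sum_div, ← hm, div_self hs.ne']⟩ hQ
    (fun a => by
      rw [div_mul_eq_mul_div]
      refine div_le_div_of_nonneg_right ?_ hs.le
      rw [onFiber]
      split_ifs with h
      · exact h ▸ le_two_pow_ratioLevel_mul (hQ.1 a) (hPQ a)
      · exact mul_nonneg (by positivity) (hQ.1 a)) (by positivity) G
  refine ⟨pos, sym, hpool, fun l => (hP _).lt_of_ne' fun h => (hsym l).ne' ?_, ?_⟩
  · simp only [onFiber, h, ite_self, zero_div]
  · calc iidMean Q (Fintype.card A) (fun l => v * (natCode (pos l)).length + G (sym l))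
        ≤ iidMean Q (Fintype.card A)
            ((fun _ => v * (4 * s + 3)) + fun l => v / 4 ^ s * (pos l + 1) + G (sym l)) := by
          refine iidMean_mono hQ.1 _ fun l => ?_
          rw [Pi.add_apply, ← add_assoc, div_mul_eq_mul_div, ← mul_div_assoc', ← mul_add]
          gcongr
          exact length_natCode_le _ _
      _ ≤ v * (4 * s + 3) + (2 * (v / 4 ^ s) * (2 ^ s / m) +
            ∑ a, onFiber (ratioLevel P Q) s P a / m * G a) := by
          rw [map_add, iidMean_const hQ]
          gcongr
      _ = _ := by
          have hpow : (4 : ℝ) ^ s = 2 ^ s * 2 ^ s := by rw [← mul_pow]; norm_num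
          rw [← add_assoc, Finset.sum_div, hpow, one_div, inv_pow]
          congr 2
          · field_simp
          · exact funext fun a => div_mul_eq_mul_div _ _ _

theorem exists_sampler_natCode {P Q : A → ℝ} (hP : P ∈ stdSimplex ℝ A)
    (hQ : Q ∈ stdSimplex ℝ A) (hPQ : ∀ a, Q a = 0 → P a = 0) {v : ℝ} (hv : 0 ≤ v)
    (G : A → ℝ) :
    ∃ (pos : List A → ℕ) (sym : List A → A), (∀ l, (pool l)[pos l]? = some (sym l)) ∧
      (∀ l, 0 < P (sym l)) ∧
      iidMean Q (Fintype.card A) (fun l => v * (natCode (pos l)).length + G (sym l)) ≤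
        v * (4 * ∑ a, P a * Real.logb 2 (P a / Q a) + 15) + ∑ a, P a * G a := by
  set m : ℕ → ℝ := fun s => ∑ a, onFiber (ratioLevel P Q) s P a
  set N : ℕ → ℝ := fun s => ∑ a, onFiber (ratioLevel P Q) s P a * G a
  set lev := ratioLevel P Q with hlev
  obtain ⟨a, ha, hbest⟩ := exists_pos_weight_le_sum hP fun a =>
    v * (4 * lev a + 3) + 2 * v * ((1 / 2) ^ lev a / m (lev a)) + N (lev a) / m (lev a)
  have hm : 0 < m (lev a) := ha.trans_le <| by
    have := Finset.single_le_sum (fun b _ => onFiber_nonneg lev (lev a) hP.1 b)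
      (Finset.mem_univ a)
    rwa [onFiber, if_pos rfl] at this
  obtain ⟨pos, sym, hpool, hsym, hmean⟩ := exists_level_sampler hP.1 hQ hPQ hv G hm
  refine ⟨pos, sym, hpool, hsym, hmean.trans (hbest.trans ?_)⟩
  have hlevels : ∑ a, P a * ((1 / 2 : ℝ) ^ lev a / m (lev a)) ≤ 2 := by
    refine (sum_mul_div_fiber_mass_le lev P (fun s => by positivity)).trans ?_
    rw [Finset.sum_set_coe (Set.range lev) (f := fun s => (1 / 2 : ℝ) ^ s)]
    exact (summable_geometric_two.sum_le_tsum _ fun s _ => by positivity).trans_eq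
      tsum_geometric_two
  have hlev_le := sum_mul_ratioLevel_le hP hQ hPQ
  rw [← hlev] at hlev_le
  have htower : ∑ a, P a * (N (lev a) / m (lev a)) = ∑ a, P a * G a :=
    sum_mul_fiber_mean lev hP.1 G
  calc _ = v * (4 * ∑ a, P a * (lev a : ℝ) + 3) +
        2 * v * ∑ a, P a * ((1 / 2) ^ lev a / m (lev a)) + ∑ a, P a * G a := by
        have hexpand (a : A) : P a * (v * (4 * lev a + 3) +
            2 * v * ((1 / 2) ^ lev a / m (lev a)) + N (lev a) / m (lev a)) =
            4 * v * (P a * lev a) + 3 * v * P a +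
              2 * v * (P a * ((1 / 2) ^ lev a / m (lev a))) +
              P a * (N (lev a) / m (lev a)) := by ring
        simp only [hexpand, Finset.sum_add_distrib, ← Finset.mul_sum, hP.2, htower]
        ring
    _ ≤ v * (4 * (∑ a, P a * Real.logb 2 (P a / Q a) + 2) + 3) + 2 * v * 2 +
        ∑ a, P a * G a := by gcongr
    _ = _ := by ring

theorem exists_message_code {X : Type*} (K : Finset X) {P : X → A → ℝ} {Q : A → ℝ}
    (hP : ∀ x ∈ K, P x ∈ stdSimplex ℝ A) (hQ : Q ∈ stdSimplex ℝ A)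
    (hPQ : ∀ x ∈ K, ∀ a, Q a = 0 → P x a = 0) {v : X → ℝ} (hv : ∀ x, 0 ≤ v x)
    (G : X → A → ℝ) :
    ∃ (enc : X → List Bool) (dec : List Bool → A),
      (∀ x x', enc x <+: enc x' → enc x = enc x') ∧ (∀ x ∈ K, 0 < P x (dec (enc x))) ∧
      ∑ x ∈ K, (v x * (enc x).length + G x (dec (enc x))) ≤
        ∑ x ∈ K, (v x * (4 * ∑ a, P x a * Real.logb 2 (P x a / Q a) + 15) +
          ∑ a, P x a * G x a) := by
  obtain ⟨a₀, -⟩ := exists_pos_weight_le_sum hQ 0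
  have : Nonempty A := ⟨a₀⟩
  choose! pos sym hpool hsym hmean using fun x (hx : x ∈ K) =>
    exists_sampler_natCode (hP x hx) hQ (hPQ x hx) (hv x) (G x)
  obtain ⟨l, hl⟩ := exists_le_iidMean hQ (Fintype.card A)
    (∑ x ∈ K, fun l => v x * (natCode (pos x l)).length + G x (sym x l))
  rw [map_sum, Finset.sum_apply] at hl
  set dec : List Bool → A := fun c => (pool l)[Function.invFun natCode c]?.getD a₀ with hdec
  have hdec_enc (x : X) (hx : x ∈ K) : dec (natCode (pos x l)) = sym x l := by
    simp only [hdec, Function.leftInverse_invFun natCode_injective _, hpool x hx l,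
      Option.getD_some]
  refine ⟨fun x => natCode (pos x l), dec, fun x x' h => congrArg natCode (natCode_prefix h),
    fun x hx => (hdec_enc x hx).symm ▸ hsym x hx l, ?_⟩
  calc _ = _ := Finset.sum_congr rfl fun x hx => by rw [hdec_enc x hx]
    _ ≤ _ := hl.trans (Finset.sum_le_sum fun x hx => hmean x hx)

end RejectionSampling

@[simp] theorem Player.other_other (p : Player) : p.other.other = p := by cases p <;> rfl

theorem speaker_succ' (p : Player) (n : ℕ) : speaker p (n + 1) = speaker p.other n := by
  induction n with
  | zero => rfl
  | succ n ih => rw [speaker, ih, speaker]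

theorem speaker_other (p : Player) (n : ℕ) : speaker p.other n = (speaker p n).other := by
  rw [← speaker_succ', speaker]

namespace Strategy

variable {I : Type u} {Z : Type w}

/-- The message sent by a player who begins. -/
def firstMsg (S : Strategy I Z) (a : I) : List Bool := S.msg a []

/-- The strategy that remains to be followed after a first message `c` has been sent. -/
def residual (S : Strategy I Z) (c : List Bool) : Strategy I Z where
  msg a h := S.msg a (c :: h)
  answer a h := S.answer a (c :: h)
  prefixFree h a b := S.prefixFree (c :: h) a b

/-- The strategy that sends empty messages only and gives the answer `z`. -/
def silent (z : I → Z) : Strategy I Z where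
  msg _ _ := []
  answer a _ := z a
  prefixFree _ _ _ _ := rfl

/-- The strategy with first message `m`, continued by `S c` if the first message of the transcript
is `c`; the answer `z` is given if there is no message at all. -/
def cons (m : I → List Bool) (hm : ∀ a b, m a <+: m b → m a = m b) (z : I → Z)
    (S : List Bool → Strategy I Z) : Strategy I Z where
  msg a h := match h with
    | [] => m a
    | c :: h => (S c).msg a h
  answer a h := match h with
    | [] => z a
    | c :: h => (S c).answer a h
  prefixFree h a b := match h with
    | [] => hm a b
    | c :: h => (S c).prefixFree h a b

/-- The strategy that cuts every message so that no more than `B` bits are sent in total. -/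
def truncate (S : Strategy I Z) (B : ℕ) : Strategy I Z where
  msg a h := (S.msg a h).take (B - h.flatten.length)
  answer := S.answer
  prefixFree h a b hab := by
    set m := B - h.flatten.length
    rcases lt_or_ge (S.msg a h).length m with hshort | hlong
    · rw [List.take_of_length_le hshort.le] at hab
      rw [S.prefixFree h a b (hab.trans (List.take_prefix _ _))]
    · refine hab.eq_of_length (le_antisymm hab.length_le ?_)
      rw [List.length_take, List.length_take]
      omega

end Strategy

open Classical in
/-- The cost of announcing `z` when the correct answer is `z'`: `0` if it is right, `1` if it is
wrong. -/
noncomputable def errorIndicator {Z : Type w} (z z' : Z) : ℝ := if z = z' then 0 else 1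

namespace DetProtocol

variable {X : Type u} {Y : Type v} {Z : Type w}

/-- The protocol that remains to be followed after a first message `c` has been sent. -/
def residual (D : DetProtocol X Y Z) (c : List Bool) : DetProtocol X Y Z :=
  ⟨D.alice.residual c, D.bob.residual c⟩

/-- The first message of the protocol. -/
def firstMsg (D : DetProtocol X Y Z) (first : Player) (x : X) (y : Y) : List Bool :=
  match first with
  | .alice => D.alice.firstMsg x
  | .bob => D.bob.firstMsg y

theorem transcript_succ (D : DetProtocol X Y Z) (first : Player) (x : X) (y : Y) (n : ℕ) :
    D.transcript first x y (n + 1) = D.firstMsg first x y ::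
      (D.residual (D.firstMsg first x y)).transcript first.other x y n := by
  induction n with
  | zero => cases first <;> rfl
  | succ n ih =>
    rw [transcript, ih, transcript, List.cons_append, ← speaker_succ']
    rfl

theorem output_succ (D : DetProtocol X Y Z) (first : Player) (x : X) (y : Y) (n : ℕ) :
    D.output first (n + 1) x y =
      (D.residual (D.firstMsg first x y)).output first.other n x y := by
  rw [output, transcript_succ, output, speaker_succ']
  rfl

/-- The protocol with the roles of the players exchanged. -/
def swap (D : DetProtocol X Y Z) : DetProtocol Y X Z := ⟨D.bob, D.alice⟩

theorem transcript_swap (D : DetProtocol X Y Z) (first : Player) (x : X) (y : Y) (n : ℕ) :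
    D.swap.transcript first.other y x n = D.transcript first x y n := by
  induction n with
  | zero => rfl
  | succ n ih =>
    rw [transcript, ih, transcript, speaker_other]
    cases speaker first n <;> rfl

theorem output_swap (D : DetProtocol X Y Z) (first : Player) (x : X) (y : Y) (n : ℕ) :
    D.swap.output first.other n y x = D.output first n x y := by
  rw [output, transcript_swap, output, speaker_other]
  cases speaker first n <;> rfl

/-- The protocol in which all messages are empty. -/
def silent (zA : X → Z) (zB : Y → Z) : DetProtocol X Y Z := ⟨.silent zA, .silent zB⟩

theorem flatten_transcript_silent (zA : X → Z) (zB : Y → Z) (first : Player) (x : X) (y : Y)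
    (n : ℕ) : ((silent zA zB).transcript first x y n).flatten = [] := by
  induction n with
  | zero => rfl
  | succ n ih => rw [transcript, List.flatten_append, ih]; cases speaker first n <;> rfl

/-- The protocol in which Alice first announces `m x`, whereupon the players follow `D (m x)`. -/
noncomputable def announce [Nonempty Z] (m : X → List Bool) (hm : ∀ a b, m a <+: m b → m a = m b)
    (D : List Bool → DetProtocol X Y Z) : DetProtocol X Y Z where
  alice := .cons m hm (fun _ => Classical.arbitrary Z) fun c => (D c).alice
  bob := .cons (fun _ => []) (fun _ _ _ => rfl) (fun _ => Classical.arbitrary Z) fun c => (D c).bob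

/-- The protocol that cuts the messages so that no more than `B` bits are sent in total. -/
def truncate (D : DetProtocol X Y Z) (B : ℕ) : DetProtocol X Y Z :=
  ⟨D.alice.truncate B, D.bob.truncate B⟩

theorem length_transcript_truncate_le (D : DetProtocol X Y Z) (B : ℕ) (first : Player) (x : X)
    (y : Y) (n : ℕ) : ((D.truncate B).transcript first x y n).flatten.length ≤ B := by
  induction n with
  | zero => exact Nat.zero_le B
  | succ n ih =>
    rw [transcript]
    cases speaker first n <;>
    · simp only [truncate, Strategy.truncate, List.flatten_append, List.length_append,
        List.flatten_cons, List.flatten_nil, List.append_nil, List.length_take] at ih ⊢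
      omega

theorem transcript_truncate {D : DetProtocol X Y Z} {B : ℕ} {first : Player} {x : X} {y : Y}
    {n : ℕ} (h : (D.transcript first x y n).flatten.length ≤ B) :
    (D.truncate B).transcript first x y n = D.transcript first x y n := by
  induction n with
  | zero => rfl
  | succ n ih =>
    simp only [transcript, List.flatten_append, List.length_append, List.flatten_cons,
      List.flatten_nil, List.append_nil] at h ⊢
    rw [ih (by omega)]
    cases hs : speaker first n <;>
    · simp only [hs] at h
      simp only [truncate, Strategy.truncate]
      rw [List.take_of_length_le (by omega)]

theorem output_truncate {D : DetProtocol X Y Z} {B : ℕ} {first : Player} {x : X} {y : Y}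
    {n : ℕ} (h : (D.transcript first x y n).flatten.length ≤ B) :
    (D.truncate B).output first n x y = D.output first n x y := by
  rw [output, transcript_truncate h, output]
  rfl

/-- The number of bits sent on input `(x, y)`, with a penalty `C` for a wrong answer. -/
noncomputable def loss (D : DetProtocol X Y Z) (C : ℝ) (f : X → Y → Z) (first : Player) (n : ℕ)
    (x : X) (y : Y) : ℝ :=
  (D.transcript first x y n).flatten.length + C * errorIndicator (D.output first n x y) (f x y)

theorem loss_swap (D : DetProtocol X Y Z) (C : ℝ) (f : X → Y → Z) (first : Player) (n : ℕ)
    (x : X) (y : Y) :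
    D.swap.loss C (fun y x => f x y) first.other n y x = D.loss C f first n x y := by
  rw [loss, transcript_swap, output_swap, loss]

theorem loss_announce [Nonempty Z] (m : X → List Bool) (hm : ∀ a b, m a <+: m b → m a = m b)
    (D : List Bool → DetProtocol X Y Z) (C : ℝ) (f : X → Y → Z) (n : ℕ) (x : X) (y : Y) :
    (announce m hm D).loss C f .alice (n + 1) x y =
      (m x).length + (D (m x)).loss C f .bob n x y := by
  have hfirst : (announce m hm D).firstMsg .alice x y = m x := rfl
  have hresidual : (announce m hm D).residual (m x) = D (m x) := rfl
  rw [loss, transcript_succ, output_succ, hfirst, hresidual, List.flatten_cons,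
    List.length_append, Nat.cast_add, add_assoc]
  rfl

end DetProtocol

section CenterMass

variable {ι κ γ : Type*} [Fintype ι] [Fintype κ] [DecidableEq γ]

theorem centerMass_eq_div (α F : ι → ℝ) :
    Finset.univ.centerMass α F = (∑ i, α i * F i) / ∑ i, α i := by
  simp only [Finset.centerMass, smul_eq_mul, div_eq_inv_mul]

theorem centerMass_comm (α : ι → ℝ) (β : κ → ℝ) (F : ι → κ → ℝ) :
    Finset.univ.centerMass α (fun i => Finset.univ.centerMass β (F i)) =
      Finset.univ.centerMass β fun j => Finset.univ.centerMass α fun i => F i j := by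
  simp only [centerMass_eq_div, mul_div_assoc', ← Finset.sum_div, Finset.mul_sum]
  rw [Finset.sum_comm, div_right_comm]
  simp only [mul_left_comm]

theorem sum_mul_centerMass {α : ι → ℝ} (hα : ∀ i, 0 ≤ α i) (F : ι → ℝ) :
    (∑ i, α i) * Finset.univ.centerMass α F = ∑ i, α i * F i := by
  rw [centerMass_eq_div, mul_div_cancel_of_imp']
  exact fun h => Finset.sum_eq_zero fun i hi => by
    rw [(Finset.sum_eq_zero_iff_of_nonneg fun i _ => hα i).1 h i hi, zero_mul]

theorem centerMass_add_const {α : ι → ℝ} (hα : 0 < ∑ i, α i) (F : ι → ℝ) (r : ℝ) :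
    Finset.univ.centerMass α (fun i => F i + r) = Finset.univ.centerMass α F + r := by
  simp only [centerMass_eq_div, mul_add, Finset.sum_add_distrib, ← Finset.sum_mul, add_div,
    mul_div_cancel_left₀ r hα.ne']

theorem centerMass_pos {α F : ι → ℝ} (hα : ∀ i, 0 ≤ α i) (hF : ∀ i, 0 ≤ F i) {i : ι}
    (hi : 0 < α i) (hFi : 0 < F i) : 0 < Finset.univ.centerMass α F := by
  rw [centerMass_eq_div]
  exact div_pos
    (Finset.sum_pos' (fun j _ => mul_nonneg (hα j) (hF j)) ⟨i, Finset.mem_univ i, mul_pos hi hFi⟩)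
    (Finset.sum_pos' (fun j _ => hα j) ⟨i, Finset.mem_univ i, hi⟩)

/-- The probability that `g` takes the value `c`, under the weights `α` normalised to a
probability distribution. -/
noncomputable def fiberProb (g : ι → γ) (α : ι → ℝ) (c : γ) : ℝ :=
  (∑ i, onFiber g c α i) / ∑ i, α i

theorem fiberProb_mem_stdSimplex (g : ι → γ) {α : ι → ℝ} (hα : ∀ i, 0 ≤ α i)
    (hpos : 0 < ∑ i, α i) :
    (fun c : Set.range g => fiberProb g α c) ∈ stdSimplex ℝ (Set.range g) := by
  refine ⟨fun c => div_nonneg (Finset.sum_nonneg fun i _ => onFiber_nonneg g c hα i) hpos.le, ?_⟩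
  simp only [fiberProb, ← Finset.sum_div, sum_range_sum_onFiber, div_self hpos.ne']

theorem sum_onFiber_pos {g : ι → γ} {α : ι → ℝ} {c : γ} (hα : ∀ i, 0 ≤ α i)
    (h : fiberProb g α c ≠ 0) : 0 < ∑ i, onFiber g c α i :=
  (Finset.sum_nonneg fun i _ => onFiber_nonneg g c hα i).lt_of_ne'
    fun h0 => h (by rw [fiberProb, h0, zero_div])

theorem fiberProb_pos {g : ι → γ} {α : ι → ℝ} {c : γ} (hα : ∀ i, 0 ≤ α i) {i : ι}
    (h : onFiber g c α i ≠ 0) : 0 < fiberProb g α c := by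
  have hi : α i ≠ 0 := fun h0 => h (by rw [onFiber, h0, ite_self])
  exact div_pos
    (Finset.sum_pos' (fun j _ => onFiber_nonneg g c hα j)
      ⟨i, Finset.mem_univ i, (onFiber_nonneg g c hα i).lt_of_ne' h⟩)
    (Finset.sum_pos' (fun j _ => hα j) ⟨i, Finset.mem_univ i, (hα i).lt_of_ne' hi⟩)

theorem fiberProb_mul_centerMass (g : ι → γ) {α : ι → ℝ} (hα : ∀ i, 0 ≤ α i) (c : γ)
    (F : ι → ℝ) : fiberProb g α c * Finset.univ.centerMass (onFiber g c α) F =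
      (∑ i, onFiber g c α i * F i) / ∑ i, α i := by
  rw [fiberProb, div_mul_eq_mul_div, sum_mul_centerMass (onFiber_nonneg g c hα)]

theorem centerMass_eq_sum_fiberProb_mul (g : ι → γ) {α : ι → ℝ} (hα : ∀ i, 0 ≤ α i)
    (F : γ → ι → ℝ) : Finset.univ.centerMass α (fun i => F (g i) i) =
      ∑ c : Set.range g, fiberProb g α c * Finset.univ.centerMass (onFiber g c α) (F c) := by
  simp only [fiberProb_mul_centerMass g hα]
  rw [centerMass_eq_div, ← Finset.sum_div, sum_range_sum_onFiber_mul]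

theorem centerMass_ite_fiber (g : ι → γ) {α : ι → ℝ} (hα : ∀ i, 0 ≤ α i) (c : γ) (F : ι → ℝ) :
    Finset.univ.centerMass α (fun i => if g i = c then F i else 0) =
      fiberProb g α c * Finset.univ.centerMass (onFiber g c α) F := by
  rw [fiberProb_mul_centerMass g hα, centerMass_eq_div]
  simp only [onFiber, mul_ite, mul_zero, ite_mul, zero_mul]

end CenterMass

section Likelihood

variable {X Y I J Z : Type*} [Fintype I] [Fintype J]

/-- The probability of the transcript `t`, when the inputs of the players are drawn independently
according to the weights `α` and `β`, normalised to probability distributions. -/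
noncomputable def likelihood (D : DetProtocol I J Z) (first : Player) (n : ℕ) (α : I → ℝ)
    (β : J → ℝ) (t : Transcript) : ℝ :=
  Finset.univ.centerMass α fun i => Finset.univ.centerMass β fun j =>
    if D.transcript first i j n = t then 1 else 0

theorem likelihood_swap (D : DetProtocol I J Z) (first : Player) (n : ℕ) (α : I → ℝ)
    (β : J → ℝ) (t : Transcript) :
    likelihood D.swap first.other n β α t = likelihood D first n α β t := by
  simp only [likelihood, DetProtocol.transcript_swap]
  exact centerMass_comm β α _

theorem likelihood_pos (D : DetProtocol I J Z) (first : Player) (n : ℕ) {α : I → ℝ} {β : J → ℝ}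
    (hα : ∀ i, 0 ≤ α i) (hβ : ∀ j, 0 ≤ β j) {i : I} {j : J} (hi : α i ≠ 0) (hj : β j ≠ 0) :
    0 < likelihood D first n α β (D.transcript first i j n) := by
  have hind (i' : I) (j' : J) : (0 : ℝ) ≤
      if D.transcript first i' j' n = D.transcript first i j n then 1 else 0 := by
    split_ifs <;> norm_num
  refine centerMass_pos hα (fun i' => ?_) ((hα i).lt_of_ne' hi)
    (centerMass_pos hβ (hind i) ((hβ j).lt_of_ne' hj) (by rw [if_pos rfl]; exact one_pos))
  rw [centerMass_eq_div]
  exact div_nonneg (Finset.sum_nonneg fun j' _ => mul_nonneg (hβ j') (hind i' j'))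
    (Finset.sum_nonneg fun j' _ => hβ j')

theorem likelihood_alice_cons (D : DetProtocol I J Z) (n : ℕ) {α : I → ℝ} (hα : ∀ i, 0 ≤ α i)
    (β : J → ℝ) (c : List Bool) (t : Transcript) :
    likelihood D .alice (n + 1) α β (c :: t) =
      fiberProb D.alice.firstMsg α c *
        likelihood (D.residual c) .bob n (onFiber D.alice.firstMsg c α) β t := by
  rw [likelihood, likelihood, ← centerMass_ite_fiber _ hα]
  refine Finset.centerMass_congr_fun fun i _ _ => ?_
  have htranscript (j : J) : D.transcript .alice i j (n + 1) = c :: t ↔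
      D.alice.firstMsg i = c ∧ (D.residual c).transcript .bob i j n = t := by
    rw [DetProtocol.transcript_succ, List.cons_eq_cons]
    exact and_congr_right fun h => by rw [← h]; rfl
  simp only [htranscript, ite_and]
  split_ifs with h
  · rfl
  · simp only [centerMass_eq_div, mul_zero, Finset.sum_const_zero, zero_div]

/-- What can be said about the private state, in `I`, of a player with an input in `X`, as
unnormalised weights: `law x` are the weights for the input `x`, `ref` the weights that do not
depend on the input. -/
structure Belief (X I : Type*) where
  /-- the weights for a given input -/
  law : X → I → ℝ
  /-- the weights for an unknown input -/
  ref : I → ℝ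
  law_nonneg : ∀ x i, 0 ≤ law x i
  ref_nonneg : ∀ i, 0 ≤ ref i
  law_eq_zero : ∀ x i, ref i = 0 → law x i = 0

/-- The belief about a player after the event that the function `g` of the private state takes the
value `c`. -/
def Belief.restrict {γ : Type*} [DecidableEq γ] (A : Belief X I) (g : I → γ) (c : γ) :
    Belief X I where
  law x := onFiber g c (A.law x)
  ref := onFiber g c A.ref
  law_nonneg x := onFiber_nonneg g c (A.law_nonneg x)
  ref_nonneg := onFiber_nonneg g c A.ref_nonneg
  law_eq_zero x i := by
    simp only [onFiber]
    split_ifs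
    exacts [A.law_eq_zero x i, fun _ => rfl]

open Classical in
/-- The belief about a player whose private state, distributed according to the weights `ref`,
determines the input by means of the function `g`. -/
noncomputable def Belief.ofRef (g : I → X) {ref : I → ℝ} (href : ∀ i, 0 ≤ ref i) :
    Belief X I where
  law x := onFiber g x ref
  ref := ref
  law_nonneg x := onFiber_nonneg g x href
  ref_nonneg := href
  law_eq_zero x i h := by rw [onFiber, h, ite_self]

theorem Belief.sum_ref_pos (A : Belief X I) {x : X} (h : 0 < ∑ i, A.law x i) :
    0 < ∑ i, A.ref i := by
  refine (Finset.sum_nonneg fun i _ => A.ref_nonneg i).lt_of_ne' fun h0 => h.ne' ?_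
  have href := (Finset.sum_eq_zero_iff_of_nonneg fun i _ => A.ref_nonneg i).1 h0
  exact Finset.sum_eq_zero fun i hi => A.law_eq_zero x i (href i hi)

theorem Belief.fiberProb_law_eq_zero {γ : Type*} [DecidableEq γ] (A : Belief X I) {g : I → γ}
    {c : γ} {x : X} (h : fiberProb g A.ref c = 0) : fiberProb g (A.law x) c = 0 := by
  by_contra hne
  obtain ⟨i, -, hi⟩ := Finset.exists_ne_zero_of_sum_ne_zero
    ((A.restrict g c).sum_ref_pos (sum_onFiber_pos (A.law_nonneg x) hne)).ne'
  exact (fiberProb_pos A.ref_nonneg hi).ne' h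

/-- The log-likelihood ratio of the transcript `t`, of the inputs being `x` and `y` against their
being unknown. -/
noncomputable def logRatio (D : DetProtocol I J Z) (first : Player) (n : ℕ) (A : Belief X I)
    (B : Belief Y J) (x : X) (y : Y) (t : Transcript) : ℝ :=
  Real.logb 2 (likelihood D first n (A.law x) (B.law y) t / likelihood D first n A.ref B.ref t)

theorem logRatio_swap (D : DetProtocol I J Z) (first : Player) (n : ℕ) (A : Belief X I)
    (B : Belief Y J) (x : X) (y : Y) (t : Transcript) :
    logRatio D.swap first.other n B A y x t = logRatio D first n A B x y t := by
  simp only [logRatio, likelihood_swap]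

theorem logRatio_alice_cons (D : DetProtocol I J Z) (n : ℕ) (A : Belief X I) (B : Belief Y J)
    {x : X} {y : Y} {c : List Bool} {i : I} {j : J}
    (hi : (A.restrict D.alice.firstMsg c).law x i ≠ 0) (hj : B.law y j ≠ 0) :
    logRatio D .alice (n + 1) A B x y (c :: (D.residual c).transcript .bob i j n) =
      logRatio (D.residual c) .bob n (A.restrict D.alice.firstMsg c) B x y
          ((D.residual c).transcript .bob i j n) +
        Real.logb 2 (fiberProb D.alice.firstMsg (A.law x) c /
          fiberProb D.alice.firstMsg A.ref c) := by
  set A' := A.restrict D.alice.firstMsg c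
  have hi_ref : A'.ref i ≠ 0 := mt (A'.law_eq_zero x i) hi
  have hj_ref : B.ref j ≠ 0 := mt (B.law_eq_zero y j) hj
  have hratio := div_pos
    (likelihood_pos (D.residual c) .bob n (A'.law_nonneg x) (B.law_nonneg y) hi hj)
    (likelihood_pos (D.residual c) .bob n A'.ref_nonneg B.ref_nonneg hi_ref hj_ref)
  have hprob := div_pos (fiberProb_pos (g := D.alice.firstMsg) (c := c) (A.law_nonneg x) hi)
    (fiberProb_pos (g := D.alice.firstMsg) A.ref_nonneg hi_ref)
  rw [logRatio, likelihood_alice_cons _ _ (A.law_nonneg x), likelihood_alice_cons _ _ A.ref_nonneg,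
    mul_div_mul_comm]
  exact (Real.logb_mul hprob.ne' hratio.ne').trans (add_comm _ _)

end Likelihood

section Compression

variable {X Y I J Z : Type*} [Fintype I] [Fintype J] {C : ℝ} {f : X → Y → Z}
  {D : DetProtocol I J Z} {first : Player} {n : ℕ} {A : Belief X I} {B : Belief Y J}

/-- The expected cost allowed for a simulation of `D` on input `(x, y)`, if the private states are
distributed according to the beliefs: four times the log-likelihood ratio of the transcript,
`15` bits per message, and a penalty `C` for a wrong answer. -/
noncomputable def expectedBudget (C : ℝ) (f : X → Y → Z) (D : DetProtocol I J Z)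
    (first : Player) (n : ℕ) (A : Belief X I) (B : Belief Y J) (x : X) (y : Y) : ℝ :=
  Finset.univ.centerMass (A.law x) fun i => Finset.univ.centerMass (B.law y) fun j =>
    C * errorIndicator (D.output first n i j) (f x y) +
      4 * logRatio D first n A B x y (D.transcript first i j n) + 15 * n

theorem expectedBudget_swap (C : ℝ) (f : X → Y → Z) (D : DetProtocol I J Z) (first : Player)
    (n : ℕ) (A : Belief X I) (B : Belief Y J) (x : X) (y : Y) :
    expectedBudget C (fun y x => f x y) D.swap first.other n B A y x =
      expectedBudget C f D first n A B x y := by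
  simp only [expectedBudget, DetProtocol.output_swap, DetProtocol.transcript_swap, logRatio_swap]
  exact centerMass_comm _ _ _

theorem expectedBudget_alice_zero {x : X} {y : Y} (hA : 0 < ∑ i, A.law x i)
    (hB : 0 < ∑ j, B.law y j) :
    expectedBudget C f D .alice 0 A B x y = Finset.univ.centerMass (A.law x) fun i =>
      C * errorIndicator (D.alice.answer i []) (f x y) := by
  have hlikelihood {α : I → ℝ} {β : J → ℝ} (hα : 0 < ∑ i, α i) (hβ : 0 < ∑ j, β j) :
      likelihood D .alice 0 α β [] = 1 := by
    refine Eq.trans (Finset.centerMass_congr_fun fun i _ _ => ?_) (Finset.centerMass_const hα.ne' 1)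
    simp only [DetProtocol.transcript, if_true]
    exact Finset.centerMass_const hβ.ne' 1
  simp only [expectedBudget, DetProtocol.transcript, DetProtocol.output, speaker, logRatio,
    hlikelihood hA hB, hlikelihood (A.sum_ref_pos hA) (B.sum_ref_pos hB), div_one, Real.logb_one,
    mul_zero, add_zero, Nat.cast_zero]
  exact Finset.centerMass_congr_fun fun i _ _ => Finset.centerMass_const hB.ne' _

theorem expectedBudget_alice_succ_eq_centerMass (C : ℝ) (f : X → Y → Z) (D : DetProtocol I J Z)
    (n : ℕ) (A : Belief X I) (B : Belief Y J) (x : X) (y : Y) :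
    expectedBudget C f D .alice (n + 1) A B x y =
      Finset.univ.centerMass (A.law x) fun i => Finset.univ.centerMass (B.law y) fun j =>
        C * errorIndicator ((D.residual (D.alice.firstMsg i)).output .bob n i j) (f x y) +
          4 * logRatio (D.residual (D.alice.firstMsg i)) .bob n
            (A.restrict D.alice.firstMsg (D.alice.firstMsg i)) B x y
            ((D.residual (D.alice.firstMsg i)).transcript .bob i j n) + 15 * n +
          (4 * Real.logb 2 (fiberProb D.alice.firstMsg (A.law x) (D.alice.firstMsg i) /
            fiberProb D.alice.firstMsg A.ref (D.alice.firstMsg i)) + 15) := by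
  refine Finset.centerMass_congr_fun fun i _ hi => Finset.centerMass_congr_fun fun j _ hj => ?_
  have hi' : (A.restrict D.alice.firstMsg (D.alice.firstMsg i)).law x i ≠ 0 := by
    change onFiber D.alice.firstMsg (D.alice.firstMsg i) (A.law x) i ≠ 0
    rwa [onFiber, if_pos rfl]
  rw [DetProtocol.output_succ, DetProtocol.transcript_succ]
  simp only [DetProtocol.firstMsg, Player.other]
  rw [logRatio_alice_cons D n A B hi' hj]
  push_cast
  ring

theorem expectedBudget_alice_succ {x : X} {y : Y} (hA : 0 < ∑ i, A.law x i)
    (hB : 0 < ∑ j, B.law y j) :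
    expectedBudget C f D .alice (n + 1) A B x y =
      4 * ∑ c : Set.range D.alice.firstMsg, fiberProb D.alice.firstMsg (A.law x) c *
          Real.logb 2 (fiberProb D.alice.firstMsg (A.law x) c /
            fiberProb D.alice.firstMsg A.ref c) + 15 +
        ∑ c : Set.range D.alice.firstMsg, fiberProb D.alice.firstMsg (A.law x) c *
          expectedBudget C f (D.residual c) .bob n (A.restrict D.alice.firstMsg c) B x y := by
  set g := D.alice.firstMsg
  set r : List Bool → ℝ := fun c =>
    4 * Real.logb 2 (fiberProb g (A.law x) c / fiberProb g A.ref c) + 15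
  have hfiber (c : Set.range g) : fiberProb g (A.law x) c * Finset.univ.centerMass
      (onFiber g c (A.law x)) (fun i => Finset.univ.centerMass (B.law y) fun j =>
        C * errorIndicator ((D.residual c).output .bob n i j) (f x y) +
          4 * logRatio (D.residual c) .bob n (A.restrict g c) B x y
            ((D.residual c).transcript .bob i j n) + 15 * n + r c) =
      fiberProb g (A.law x) c *
        (expectedBudget C f (D.residual c) .bob n (A.restrict g c) B x y + r c) := by
    rcases eq_or_ne (fiberProb g (A.law x) c) 0 with h | h
    · rw [h, zero_mul, zero_mul]
    · simp_rw [centerMass_add_const hB _ (r c)]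
      rw [centerMass_add_const (sum_onFiber_pos (A.law_nonneg x) h)]
      rfl
  rw [expectedBudget_alice_succ_eq_centerMass, centerMass_eq_sum_fiberProb_mul g (A.law_nonneg x)
    fun c i => Finset.univ.centerMass (B.law y) fun j =>
      C * errorIndicator ((D.residual c).output .bob n i j) (f x y) +
        4 * logRatio (D.residual c) .bob n (A.restrict g c) B x y
          ((D.residual c).transcript .bob i j n) + 15 * n + r c,
    Finset.sum_congr rfl fun c _ => hfiber c]
  have htotal : ∑ c : Set.range g, fiberProb g (A.law x) c = 1 :=
    (fiberProb_mem_stdSimplex g (A.law_nonneg x) hA).2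
  simp only [r, mul_add, Finset.sum_add_distrib, ← Finset.sum_mul, htotal, Finset.mul_sum]
  simp only [mul_left_comm, one_mul]
  ring

variable [Fintype X] [Fintype Y]

/-- The `n`-message protocol `D` on private states can be simulated by a deterministic protocol on
the inputs: for any weighting of the inputs, at a loss within the budget on average. -/
def Compressible (C : ℝ) (f : X → Y → Z) (D : DetProtocol I J Z) (first : Player) (n : ℕ)
    (A : Belief X I) (B : Belief Y J) : Prop :=
  ∀ w : X → Y → ℝ, (∀ x y, 0 ≤ w x y) →
    (∀ x y, w x y ≠ 0 → 0 < ∑ i, A.law x i ∧ 0 < ∑ j, B.law y j) →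
    ∃ D' : DetProtocol X Y Z, ∑ x, ∑ y, w x y * D'.loss C f first n x y ≤
      ∑ x, ∑ y, w x y * expectedBudget C f D first n A B x y

theorem Compressible.of_swap
    (h : Compressible C (fun y x => f x y) D.swap first.other n B A) :
    Compressible C f D first n A B := by
  intro w hw hpos
  obtain ⟨D', hD'⟩ := h (fun y x => w x y) (fun y x => hw x y) fun y x h => (hpos x y h).symm
  refine ⟨D'.swap, ?_⟩
  simp only [expectedBudget_swap, ← DetProtocol.loss_swap D', Player.other_other] at hD'
  calc ∑ x, ∑ y, w x y * D'.swap.loss C f first n x y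
      = ∑ y, ∑ x, w x y * D'.swap.loss C f first n x y := Finset.sum_comm
    _ ≤ ∑ y, ∑ x, w x y * expectedBudget C f D first n A B x y := hD'
    _ = ∑ x, ∑ y, w x y * expectedBudget C f D first n A B x y := Finset.sum_comm

theorem Compressible.alice_zero [Nonempty Z] : Compressible C f D .alice 0 A B := by
  intro w _ hpos
  have hanswer (x : X) : ∃ z : Z, ∑ y, w x y * (C * errorIndicator z (f x y)) ≤
      ∑ y, w x y * expectedBudget C f D .alice 0 A B x y := by
    by_cases hA : 0 < ∑ i, A.law x i
    · obtain ⟨i, -, hi⟩ := exists_pos_weight_le_sum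
        (p := fun i => A.law x i / ∑ i', A.law x i')
        ⟨fun i => div_nonneg (A.law_nonneg x i) hA.le, by rw [← Finset.sum_div, div_self hA.ne']⟩
        fun i => ∑ y, w x y * (C * errorIndicator (D.alice.answer i []) (f x y))
      refine ⟨D.alice.answer i [], hi.trans_eq ?_⟩
      simp only [Finset.mul_sum]
      rw [Finset.sum_comm]
      refine Finset.sum_congr rfl fun y _ => ?_
      rcases eq_or_ne (w x y) 0 with hw | hw
      · simp only [hw, zero_mul, mul_zero, Finset.sum_const_zero]
      · rw [expectedBudget_alice_zero hA (hpos x y hw).2, centerMass_eq_div, Finset.sum_div,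
          Finset.mul_sum]
        exact Finset.sum_congr rfl fun i _ => by ring
    · have hw (y : Y) : w x y = 0 := by_contra fun h => hA (hpos x y h).1
      exact ⟨Classical.arbitrary Z, by simp only [hw, zero_mul, le_refl]⟩
  choose z hz using hanswer
  refine ⟨.silent z fun _ => Classical.arbitrary Z, Finset.sum_le_sum fun x _ => ?_⟩
  simpa [DetProtocol.loss, DetProtocol.transcript, DetProtocol.output, DetProtocol.silent,
    speaker, Strategy.silent] using hz x

theorem exists_family_of_compressible {S : Type*} [Finite S] {D : S → DetProtocol I J Z}
    {A : S → Belief X I} (h : ∀ c, Compressible C f (D c) first n (A c) B) {w : X → Y → ℝ}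
    (hw : ∀ x y, 0 ≤ w x y) (σ : X → S)
    (hpos : ∀ x y, w x y ≠ 0 → 0 < ∑ i, (A (σ x)).law x i ∧ 0 < ∑ j, B.law y j) :
    ∃ D' : S → DetProtocol X Y Z,
      ∑ x, ∑ y, w x y * (D' (σ x)).loss C f first n x y ≤
        ∑ x, ∑ y, w x y * expectedBudget C f (D (σ x)) first n (A (σ x)) B x y := by
  classical
  have := Fintype.ofFinite S
  choose D' hD' using fun c => h c (fun x y => if σ x = c then w x y else 0)
    (fun x y => by split_ifs; exacts [hw x y, le_rfl])
    (fun x y hxy => by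
      obtain ⟨rfl, hne⟩ := ite_ne_right_iff.1 hxy
      exact hpos x y hne)
  refine ⟨D', ?_⟩
  have hselect (F : S → X → Y → ℝ) : ∑ x, ∑ y, w x y * F (σ x) x y =
      ∑ c, ∑ x, ∑ y, (if σ x = c then w x y else 0) * F c x y := by
    refine Eq.trans (Finset.sum_congr rfl fun x _ => ?_) Finset.sum_comm
    refine Eq.trans (Finset.sum_congr rfl fun y _ => ?_) Finset.sum_comm
    simp only [ite_mul, zero_mul, Finset.sum_ite_eq, Finset.mem_univ, if_true]
  rw [hselect fun c => (D' c).loss C f first n,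
    hselect fun c => expectedBudget C f (D c) first n (A c) B]
  exact Finset.sum_le_sum fun c _ => hD' c

theorem exists_firstMsg_code {w : X → Y → ℝ} (hw : ∀ x y, 0 ≤ w x y)
    (hpos : ∀ x y, w x y ≠ 0 → 0 < ∑ i, A.law x i ∧ 0 < ∑ j, B.law y j) {x₀ : X}
    (hx₀ : 0 < ∑ i, A.law x₀ i) :
    ∃ (enc : X → List Bool) (dec : List Bool → Set.range D.alice.firstMsg),
      (∀ x x', enc x <+: enc x' → enc x = enc x') ∧
      (∀ x y, w x y ≠ 0 → 0 < ∑ i, (A.restrict D.alice.firstMsg (dec (enc x))).law x i) ∧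
      ∑ x, ∑ y, w x y * ((enc x).length + expectedBudget C f (D.residual (dec (enc x))) .bob n
          (A.restrict D.alice.firstMsg (dec (enc x))) B x y) ≤
        ∑ x, ∑ y, w x y * expectedBudget C f D .alice (n + 1) A B x y := by
  classical
  set g := D.alice.firstMsg
  set K : Finset X := Finset.univ.filter fun x => 0 < ∑ i, A.law x i with hK
  have hK_iff (x : X) : x ∈ K ↔ 0 < ∑ i, A.law x i := by simp [hK]
  have hrestrict (F : X → Y → ℝ) : ∑ x, ∑ y, w x y * F x y = ∑ x ∈ K, ∑ y, w x y * F x y := by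
    refine (Finset.sum_subset K.subset_univ fun x _ hx => Finset.sum_eq_zero fun y _ => ?_).symm
    rw [by_contra fun h => hx ((hK_iff x).2 (hpos x y h).1), zero_mul]
  set E : Set.range g → X → Y → ℝ := fun c =>
    expectedBudget C f (D.residual c) .bob n (A.restrict g c) B
  obtain ⟨enc, dec, hprefix, hdec, hcode⟩ := exists_message_code K
    (P := fun x (c : Set.range g) => fiberProb g (A.law x) c)
    (fun x hx => fiberProb_mem_stdSimplex g (A.law_nonneg x) ((hK_iff x).1 hx))
    (fiberProb_mem_stdSimplex g A.ref_nonneg (A.sum_ref_pos hx₀))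
    (fun x _ c => A.fiberProb_law_eq_zero) (v := fun x => ∑ y, w x y)
    (fun x => Finset.sum_nonneg fun y _ => hw x y) fun x c => ∑ y, w x y * E c x y
  refine ⟨enc, dec, hprefix, fun x y h => sum_onFiber_pos (A.law_nonneg x)
    (hdec x ((hK_iff x).2 (hpos x y h).1)).ne', ?_⟩
  have hbudget (x : X) (hx : x ∈ K) : ∑ y, w x y * expectedBudget C f D .alice (n + 1) A B x y =
      (∑ y, w x y) * (4 * ∑ c : Set.range g, fiberProb g (A.law x) c *
          Real.logb 2 (fiberProb g (A.law x) c / fiberProb g A.ref c) + 15) +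
        ∑ c : Set.range g, fiberProb g (A.law x) c * ∑ y, w x y * E c x y := by
    simp only [Finset.mul_sum (s := (Finset.univ : Finset Y))]
    rw [Finset.sum_comm (s := (Finset.univ : Finset (Set.range g))), Finset.sum_mul,
      ← Finset.sum_add_distrib]
    refine Finset.sum_congr rfl fun y _ => ?_
    rcases eq_or_ne (w x y) 0 with h | h
    · simp only [h, zero_mul, mul_zero, Finset.sum_const_zero, add_zero]
    · rw [expectedBudget_alice_succ ((hK_iff x).1 hx) (hpos x y h).2, mul_add,
        Finset.mul_sum _ _ (w x y)]
      exact congrArg _ (Finset.sum_congr rfl fun c _ => mul_left_comm _ _ _)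
  rw [hrestrict, hrestrict, Finset.sum_congr rfl hbudget]
  refine le_trans (Finset.sum_congr rfl fun x _ => ?_).le hcode
  simp only [mul_add, Finset.sum_add_distrib, ← Finset.sum_mul, E]

theorem Compressible.alice_succ [Nonempty Z]
    (ih : ∀ c, Compressible C f (D.residual c) .bob n (A.restrict D.alice.firstMsg c) B) :
    Compressible C f D .alice (n + 1) A B := by
  intro w hw hpos
  by_cases hA : ∃ x, 0 < ∑ i, A.law x i
  · obtain ⟨x₀, hx₀⟩ := hA
    obtain ⟨enc, dec, hprefix, hdec, hcode⟩ :=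
      exists_firstMsg_code (C := C) (f := f) (n := n) hw hpos hx₀
    obtain ⟨D', hD'⟩ := exists_family_of_compressible
      (fun c : Set.range D.alice.firstMsg => ih c) hw (fun x => dec (enc x))
      fun x y h => ⟨hdec x y h, (hpos x y h).2⟩
    refine ⟨.announce enc hprefix fun m => D' (dec m), le_trans ?_ hcode⟩
    simp only [DetProtocol.loss_announce, mul_add, Finset.sum_add_distrib]
    gcongr
  · have hw_zero (x : X) (y : Y) : w x y = 0 := by_contra fun h => hA ⟨x, (hpos x y h).1⟩
    exact ⟨.silent (fun _ => Classical.arbitrary Z) fun _ => Classical.arbitrary Z,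
      by simp only [hw_zero, zero_mul, le_refl]⟩

theorem compressible [Nonempty Z] (C : ℝ) (f : X → Y → Z) (D : DetProtocol I J Z)
    (first : Player) (n : ℕ) (A : Belief X I) (B : Belief Y J) :
    Compressible C f D first n A B := by
  induction n generalizing first D A B with
  | zero =>
    cases first
    · exact .alice_zero
    · exact .of_swap .alice_zero
  | succ n ih =>
    cases first
    · exact .alice_succ fun c => ih _ _ _ _
    · exact .of_swap (.alice_succ fun c => .of_swap (ih _ _ _ _))

end Compression

theorem exists_expected_loss_le {X Y I J Z : Type*} [Finite X] [Finite Y] [Fintype I] [Fintype J]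
    [Nonempty Z] (C : ℝ) (f : X → Y → Z) (D : DetProtocol I J Z) (first : Player) (n : ℕ)
    (g : I → X) (h : J → Y) {α : I → ℝ} {β : J → ℝ} (hα : ∀ i, 0 ≤ α i) (hβ : ∀ j, 0 ≤ β j) :
    ∃ D' : DetProtocol X Y Z, ∑ i, α i * ∑ j, β j * D'.loss C f first n (g i) (h j) ≤
      ∑ i, α i * ∑ j, β j * (C * errorIndicator (D.output first n i j) (f (g i) (h j)) +
        4 * logRatio D first n (.ofRef g hα) (.ofRef h hβ) (g i) (h j)
          (D.transcript first i j n) + 15 * n) := by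
  classical
  have := Fintype.ofFinite X
  have := Fintype.ofFinite Y
  set A : Belief X I := .ofRef g hα
  set B : Belief Y J := .ofRef h hβ
  have hsum (F : X → Y → I → J → ℝ) : ∑ i, α i * ∑ j, β j * F (g i) (h j) i j =
      ∑ x, ∑ y, ∑ i, A.law x i * ∑ j, B.law y j * F x y i j := by
    simp only [Finset.sum_comm (s := (Finset.univ : Finset Y)) (t := (Finset.univ : Finset I)),
      ← Finset.mul_sum]
    simp only [A, B, Belief.ofRef]
    convert (sum_sum_onFiber_mul g α fun x i => ∑ y, ∑ j, onFiber h y β j * F x y i j).symm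
      using 4 with i
    exact (sum_sum_onFiber_mul h β fun y j => F (g i) y i j).symm
  obtain ⟨D', hD'⟩ := compressible C f D first n A B
    (fun x y => (∑ i, A.law x i) * ∑ j, B.law y j)
    (fun x y => mul_nonneg (Finset.sum_nonneg fun i _ => A.law_nonneg x i)
      (Finset.sum_nonneg fun j _ => B.law_nonneg y j))
    fun x y hxy => ⟨(Finset.sum_nonneg fun i _ => A.law_nonneg x i).lt_of_ne'
      (left_ne_zero_of_mul hxy), (Finset.sum_nonneg fun j _ => B.law_nonneg y j).lt_of_ne'
      (right_ne_zero_of_mul hxy)⟩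
  refine ⟨D', ?_⟩
  rw [hsum fun x y _ _ => D'.loss C f first n x y, hsum fun x y i j =>
    C * errorIndicator (D.output first n i j) (f x y) +
      4 * logRatio D first n A B x y (D.transcript first i j n) + 15 * n]
  convert hD' using 4 with x _ y _ x _ y _
  · simp only [← Finset.sum_mul, mul_assoc]
  · rw [expectedBudget, mul_right_comm, sum_mul_centerMass (A.law_nonneg x), Finset.sum_mul]
    refine Finset.sum_congr rfl fun i _ => ?_
    rw [mul_assoc, mul_comm (Finset.centerMass _ _ _), sum_mul_centerMass (B.law_nonneg y)]

section Information

variable {Ω Ω' γ γ' : Type*}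

theorem toReal_mem_stdSimplex [Fintype Ω] (p : PMF Ω) :
    (fun ω => (p ω).toReal) ∈ stdSimplex ℝ Ω := by
  refine ⟨fun ω => ENNReal.toReal_nonneg, ?_⟩
  rw [← ENNReal.toReal_sum fun ω _ => p.apply_ne_top ω, ← tsum_fintype (L := .unconditional _),
    p.tsum_coe, ENNReal.toReal_one]

theorem sum_toReal_comp_le_one {ι : Type*} [Fintype ι] (p : PMF Ω) {g : ι → Ω}
    (hg : Function.Injective g) : ∑ i, (p (g i)).toReal ≤ 1 := by
  rw [← ENNReal.toReal_sum fun i _ => p.apply_ne_top _]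
  refine ENNReal.toReal_le_of_le_ofReal zero_le_one ?_
  rw [ENNReal.ofReal_one, ← p.tsum_coe, ← tsum_fintype (L := .unconditional _)]
  exact ENNReal.tsum_comp_le_tsum_of_injective hg p

theorem toReal_map_apply [Fintype Ω] [DecidableEq γ] (p : PMF Ω) (g : Ω → γ) (c : γ) :
    (p.map g c).toReal = ∑ ω, onFiber g c (fun ω => (p ω).toReal) ω := by
  classical
  rw [PMF.map_apply, tsum_fintype, ENNReal.toReal_sum fun ω _ => by
    split_ifs
    exacts [p.apply_ne_top ω, ENNReal.zero_ne_top]]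
  refine Finset.sum_congr rfl fun ω _ => ?_
  by_cases h : g ω = c
  · rw [onFiber, if_pos h, if_pos h.symm]
  · rw [onFiber, if_neg h, if_neg (Ne.symm h), ENNReal.toReal_zero]

theorem toReal_map_apply_pos {p : PMF Ω} {ω : Ω} (h : p ω ≠ 0) (g : Ω → γ) :
    0 < (p.map g (g ω)).toReal := by
  refine ENNReal.toReal_pos ?_ (PMF.apply_ne_top _ _)
  exact (PMF.mem_support_map_iff _ _ _).2 ⟨ω, h, rfl⟩

theorem entropy_map [Fintype Ω] (p : PMF Ω) (g : Ω → γ) : entropy (p.map g) =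
    -∑ ω, (p ω).toReal * Real.logb 2 (p.map g (g ω)).toReal := by
  classical
  rw [entropy, neg_inj, sum_mul_comp_eq_sum_range g (fun ω => (p ω).toReal)
    fun c => Real.logb 2 (p.map g c).toReal, tsum_eq_sum (s := (Set.range g).toFinset)]
  · simp only [← toReal_map_apply]
    exact (Finset.sum_subtype _ (fun c => Set.mem_toFinset) _)
  · intro c hc
    have h0 : p.map g c = 0 := by
      rw [PMF.apply_eq_zero_iff, PMF.mem_support_map_iff]
      rintro ⟨ω, -, rfl⟩
      exact hc (Set.mem_toFinset.2 ⟨ω, rfl⟩)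
    rw [h0, ENNReal.toReal_zero, zero_mul]

/-- The product of two distributions. -/
noncomputable def prodLaw (p : PMF Ω) (q : PMF Ω') : PMF (Ω × Ω') :=
  p.bind fun ω => q.map (Prod.mk ω)

theorem prodLaw_apply (p : PMF Ω) (q : PMF Ω') (s : Ω × Ω') : prodLaw p q s = p s.1 * q s.2 := by
  classical
  rw [prodLaw, PMF.bind_apply, tsum_eq_single s.1, PMF.map_apply, tsum_eq_single s.2, if_pos rfl]
  · exact fun ω' h => if_neg fun h' => h (congrArg Prod.snd h').symm
  · intro ω h
    have h0 : q.map (Prod.mk ω) s = 0 := by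
      rw [PMF.apply_eq_zero_iff, PMF.mem_support_map_iff]
      rintro ⟨ω', -, rfl⟩
      exact h rfl
    rw [h0, mul_zero]

theorem mutualInfo_map [Fintype Ω] (p : PMF Ω) (g : Ω → γ) (h : Ω → γ') :
    mutualInfo (p.map fun ω => (g ω, h ω)) = ∑ ω, (p ω).toReal *
      Real.logb 2 ((p.map (fun ω => (g ω, h ω)) (g ω, h ω)).toReal /
        ((p.map g (g ω)).toReal * (p.map h (h ω)).toReal)) := by
  have hfst : (p.map fun ω => (g ω, h ω)).map Prod.fst = p.map g := PMF.map_comp _ _ _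
  have hsnd : (p.map fun ω => (g ω, h ω)).map Prod.snd = p.map h := PMF.map_comp _ _ _
  rw [mutualInfo, hfst, hsnd, entropy_map, entropy_map, entropy_map, sub_neg_eq_add, ← neg_add,
    ← Finset.sum_add_distrib, ← Finset.sum_neg_distrib, ← Finset.sum_add_distrib]
  refine Finset.sum_congr rfl fun ω _ => ?_
  rcases eq_or_ne (p ω) 0 with h0 | h0
  · simp only [h0, ENNReal.toReal_zero, zero_mul, add_zero, neg_zero]
  · have hg := (toReal_map_apply_pos h0 g).ne'
    have hh := (toReal_map_apply_pos h0 h).ne'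
    rw [Real.logb_div (toReal_map_apply_pos h0 fun ω => (g ω, h ω)).ne' (mul_ne_zero hg hh),
      Real.logb_mul hg hh]
    ring

theorem mutualInfo_map_nonneg [Finite Ω] (p : PMF Ω) (g : Ω → γ) (h : Ω → γ') :
    0 ≤ mutualInfo (p.map fun ω => (g ω, h ω)) := by
  classical
  have := Fintype.ofFinite Ω
  set gh : Ω → γ × γ' := fun ω => (g ω, h ω)
  set q := prodLaw (p.map g) (p.map h)
  have hratio : ∑ ω, (p ω).toReal * ((q (gh ω)).toReal / (p.map gh (gh ω)).toReal) ≤ 1 := by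
    simp only [toReal_map_apply p gh]
    exact (sum_mul_div_fiber_mass_le gh _ fun c => ENNReal.toReal_nonneg).trans
      (sum_toReal_comp_le_one q Subtype.val_injective)
  have hlog (ω : Ω) : (p ω).toReal * (1 - (q (gh ω)).toReal / (p.map gh (gh ω)).toReal) ≤
      (p ω).toReal * Real.log ((p.map gh (gh ω)).toReal / (q (gh ω)).toReal) := by
    rcases eq_or_ne (p ω) 0 with h0 | h0
    · simp only [h0, ENNReal.toReal_zero, zero_mul, le_refl]
    · have hq : 0 < (q (gh ω)).toReal := by
        rw [prodLaw_apply, ENNReal.toReal_mul]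
        exact mul_pos (toReal_map_apply_pos h0 g) (toReal_map_apply_pos h0 h)
      rw [← inv_div]
      exact mul_le_mul_of_nonneg_left
        (Real.one_sub_inv_le_log_of_pos (div_pos (toReal_map_apply_pos h0 gh) hq))
        ENNReal.toReal_nonneg
  have hsum := Finset.sum_le_sum fun ω (_ : ω ∈ Finset.univ) => hlog ω
  simp only [mul_sub, mul_one, Finset.sum_sub_distrib, (toReal_mem_stdSimplex p).2] at hsum
  have hq (ω : Ω) : (p.map g (g ω)).toReal * (p.map h (h ω)).toReal = (q (gh ω)).toReal := by
    rw [prodLaw_apply, ENNReal.toReal_mul]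
  rw [mutualInfo_map]
  simp only [hq, Real.logb, mul_div_assoc', ← Finset.sum_div]
  exact div_nonneg (by linarith) (Real.log_nonneg one_le_two)

end Information

section MutualInfoOfTranscript

theorem toReal_prodLaw {Ω Ω' : Type*} (p : PMF Ω) (q : PMF Ω') (s : Ω × Ω') :
    (prodLaw p q s).toReal = (p s.1).toReal * (q s.2).toReal := by
  rw [prodLaw_apply, ENNReal.toReal_mul]

theorem sum_prodLaw_mul {Ω Ω' : Type*} [Fintype Ω] [Fintype Ω'] (p : PMF Ω) (q : PMF Ω')
    (F : Ω → Ω' → ℝ) : ∑ s, (prodLaw p q s).toReal * F s.1 s.2 =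
      ∑ ω, (p ω).toReal * ∑ ω', (q ω').toReal * F ω ω' := by
  simp only [toReal_prodLaw, Fintype.sum_prod_type, Finset.mul_sum, mul_assoc]

theorem sum_map_mul {Ω γ : Type*} [Fintype Ω] [Fintype γ] (p : PMF Ω) (g : Ω → γ) (F : γ → ℝ) :
    ∑ c, (p.map g c).toReal * F c = ∑ ω, (p ω).toReal * F (g ω) := by
  classical
  simp only [toReal_map_apply, Finset.sum_mul]
  exact sum_sum_onFiber_mul g _ fun c _ => F c

variable {X Y I J Z : Type*} [Fintype I] [Fintype J]

theorem likelihood_eq_fiberProb (D : DetProtocol I J Z) (first : Player) (n : ℕ) (α : I → ℝ)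
    (β : J → ℝ) (t : Transcript) : likelihood D first n α β t =
      fiberProb (fun s : I × J => D.transcript first s.1 s.2 n) (fun s => α s.1 * β s.2) t := by
  simp only [likelihood, fiberProb, onFiber, centerMass_eq_div, Fintype.sum_prod_type,
    mul_div_assoc', ← Finset.sum_div, ← Finset.sum_mul_sum, div_div, Finset.mul_sum, mul_ite,
    mul_one, mul_zero, mul_comm (∑ j, β j)]

theorem likelihood_toReal (D : DetProtocol I J Z) (first : Player) (n : ℕ) (p : PMF I)
    (q : PMF J) (t : Transcript) :
    likelihood D first n (fun i => (p i).toReal) (fun j => (q j).toReal) t =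
      ((prodLaw p q).map (fun s => D.transcript first s.1 s.2 n) t).toReal := by
  simp only [likelihood_eq_fiberProb, fiberProb, ← toReal_prodLaw, toReal_map_apply,
    (toReal_mem_stdSimplex (prodLaw p q)).2, div_one]

theorem likelihood_onFiber_toReal [DecidableEq X] [DecidableEq Y] (D : DetProtocol I J Z)
    (first : Player) (n : ℕ) (g : I → X) (h : J → Y) (p : PMF I) (q : PMF J) (x : X) (y : Y)
    (t : Transcript) :
    likelihood D first n (onFiber g x fun i => (p i).toReal) (onFiber h y fun j => (q j).toReal) t =
      ((prodLaw p q).map (fun s => ((g s.1, h s.2), D.transcript first s.1 s.2 n))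
          ((x, y), t)).toReal /
        ((prodLaw p q).map (fun s => (g s.1, h s.2)) (x, y)).toReal := by
  simp only [likelihood_eq_fiberProb, fiberProb, toReal_map_apply, toReal_prodLaw, onFiber,
    Prod.mk.injEq, ite_zero_mul_ite_zero, ← ite_and, and_comm]

theorem mutualInfo_transcript (D : DetProtocol I J Z) (first : Player) (n : ℕ) (g : I → X)
    (h : J → Y) (p : PMF I) (q : PMF J) :
    mutualInfo ((prodLaw p q).map fun s => ((g s.1, h s.2), D.transcript first s.1 s.2 n)) =
      ∑ s, (prodLaw p q s).toReal * logRatio D first n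
        (.ofRef g fun i => (p i).toReal_nonneg) (.ofRef h fun j => (q j).toReal_nonneg)
        (g s.1) (h s.2) (D.transcript first s.1 s.2 n) := by
  classical
  rw [mutualInfo_map]
  refine Finset.sum_congr rfl fun s _ => ?_
  rw [logRatio, Belief.ofRef, Belief.ofRef, likelihood_toReal, likelihood_onFiber_toReal, div_div]

theorem exists_expected_loss_le_mutualInfo [Finite X] [Finite Y] [Nonempty Z] (C : ℝ)
    (f : X → Y → Z) (D : DetProtocol I J Z) (first : Player) (n : ℕ) (g : I → X) (h : J → Y)
    (p : PMF I) (q : PMF J) :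
    ∃ D' : DetProtocol X Y Z,
      ∑ s, (prodLaw p q s).toReal * D'.loss C f first n (g s.1) (h s.2) ≤
        C * (∑ s, (prodLaw p q s).toReal *
            errorIndicator (D.output first n s.1 s.2) (f (g s.1) (h s.2))) +
          4 * mutualInfo
            ((prodLaw p q).map fun s => ((g s.1, h s.2), D.transcript first s.1 s.2 n)) +
          15 * n := by
  obtain ⟨D', hD'⟩ := exists_expected_loss_le C f D first n g h
    (fun i => (p i).toReal_nonneg) (fun j => (q j).toReal_nonneg)
  simp only [← sum_prodLaw_mul p q fun i j => D'.loss C f first n (g i) (h j),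
    ← sum_prodLaw_mul p q fun i j =>
      C * errorIndicator (D.output first n i j) (f (g i) (h j)) +
        4 * logRatio D first n (.ofRef g fun i => (p i).toReal_nonneg)
          (.ofRef h fun j => (q j).toReal_nonneg) (g i) (h j) (D.transcript first i j n) +
        15 * n] at hD'
  refine ⟨D', hD'.trans_eq ?_⟩
  simp only [mutualInfo_transcript, mul_add, Finset.sum_add_distrib, ← Finset.sum_mul,
    (toReal_mem_stdSimplex (prodLaw p q)).2, one_mul, mul_left_comm _ C, mul_left_comm _ (4 : ℝ),
    ← Finset.mul_sum]

end MutualInfoOfTranscript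

section PrivateCoins

variable {X : Type u} {Y : Type v} {Z : Type w}

theorem IsProduct.exists_eq_prodLaw {μ : PMF (X × Y)} (hμ : IsProduct μ) :
    ∃ (μX : PMF X) (μY : PMF Y), μ = prodLaw μX μY := by
  obtain ⟨μX, μY, h⟩ := hμ
  exact ⟨μX, μY, PMF.ext fun s => (h s.1 s.2).trans (prodLaw_apply μX μY s).symm⟩

theorem map_prodProdProdComm_prodLaw {A B C D : Type*} (a : PMF A) (b : PMF B) (c : PMF C)
    (d : PMF D) : (prodLaw (prodLaw a b) (prodLaw c d)).map (Equiv.prodProdProdComm A B C D) =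
      prodLaw (prodLaw a c) (prodLaw b d) := by
  simp only [prodLaw, PMF.map, PMF.bind_bind, PMF.pure_bind, Function.comp_apply,
    Equiv.prodProdProdComm_apply]
  exact congrArg a.bind (funext fun x => PMF.bind_comm b c _)

theorem sum_mul_errorIndicator {Ω : Type*} [Fintype Ω] (p : PMF Ω) (g : Ω → Z) (z : Z) :
    ∑ ω, (p ω).toReal * errorIndicator (g ω) z = 1 - (p.map g z).toReal := by
  classical
  rw [eq_sub_iff_add_eq, toReal_map_apply, ← Finset.sum_add_distrib,
    ← (toReal_mem_stdSimplex p).2]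
  refine Finset.sum_congr rfl fun ω _ => ?_
  by_cases h : g ω = z <;> simp [errorIndicator, onFiber, h]

namespace PrivateCoinProtocol

variable (P : PrivateCoinProtocol X Y Z) (first : Player) (k : ℕ)

theorem outputLaw_eq_map (x : X) (y : Y) : P.outputLaw first k x y =
    (prodLaw P.coinA P.coinB).map fun c => P.det.output first k (x, c.1) (y, c.2) := by
  simp only [outputLaw, prodLaw, PMF.map, PMF.bind_bind, PMF.pure_bind, Function.comp_apply]

theorem jointLaw_prodLaw (μX : PMF X) (μY : PMF Y) : P.jointLaw first k (prodLaw μX μY) =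
    (prodLaw (prodLaw μX P.coinA) (prodLaw μY P.coinB)).map fun s =>
      ((s.1.1, s.2.1), P.det.transcript first s.1 s.2 k) := by
  have hjoint : P.jointLaw first k (prodLaw μX μY) =
      (prodLaw (prodLaw μX μY) (prodLaw P.coinA P.coinB)).map fun s =>
        (s.1, P.det.transcript first (s.1.1, s.2.1) (s.1.2, s.2.2) k) := by
    simp only [jointLaw, transcriptLaw, prodLaw, PMF.map, PMF.bind_bind, PMF.pure_bind,
      Function.comp_apply]
  rw [hjoint, ← map_prodProdProdComm_prodLaw, PMF.map_comp]
  rfl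

theorem infoCost_nonneg [Finite X] [Finite Y] {μ : PMF (X × Y)} (hμ : IsProduct μ) :
    0 ≤ P.infoCost first k μ := by
  obtain ⟨μX, μY, rfl⟩ := hμ.exists_eq_prodLaw
  rw [infoCost, jointLaw_prodLaw]
  exact mutualInfo_map_nonneg _ _ _

variable {P first k}

theorem IsErrorProtocol.sum_errorIndicator_le {δ : ℝ} {f : X → Y → Z}
    (hP : P.IsErrorProtocol first k δ f) (x : X) (y : Y) :
    ∑ c, (prodLaw P.coinA P.coinB c).toReal *
      errorIndicator (P.det.output first k (x, c.1) (y, c.2)) (f x y) ≤ δ := by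
  rw [sum_mul_errorIndicator (prodLaw P.coinA P.coinB)
    fun c => P.det.output first k (x, c.1) (y, c.2), sub_le_comm, ← outputLaw_eq_map]
  exact hP x y

theorem IsErrorProtocol.sum_mul_errorIndicator_le [Fintype X] [Fintype Y] {δ : ℝ} {f : X → Y → Z}
    (hP : P.IsErrorProtocol first k δ f) (μX : PMF X) (μY : PMF Y) :
    ∑ s, (prodLaw (prodLaw μX P.coinA) (prodLaw μY P.coinB) s).toReal *
      errorIndicator (P.det.output first k s.1 s.2) (f s.1.1 s.2.1) ≤ δ := by
  have hreorder := sum_map_mul (prodLaw (prodLaw μX P.coinA) (prodLaw μY P.coinB))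
    (Equiv.prodProdProdComm X (Fin P.nA) Y (Fin P.nB)) fun s =>
      errorIndicator (P.det.output first k (s.1.1, s.2.1) (s.1.2, s.2.2)) (f s.1.1 s.1.2)
  rw [map_prodProdProdComm_prodLaw, sum_prodLaw_mul (prodLaw μX μY)
    (prodLaw P.coinA P.coinB) fun xy c =>
    errorIndicator (P.det.output first k (xy.1, c.1) (xy.2, c.2)) (f xy.1 xy.2)] at hreorder
  calc _ = ∑ xy, (prodLaw μX μY xy).toReal * ∑ c, (prodLaw P.coinA P.coinB c).toReal *
        errorIndicator (P.det.output first k (xy.1, c.1) (xy.2, c.2)) (f xy.1 xy.2) :=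
      hreorder.symm
    _ ≤ ∑ xy, (prodLaw μX μY xy).toReal * δ := Finset.sum_le_sum fun xy _ =>
      mul_le_mul_of_nonneg_left (hP.sum_errorIndicator_le xy.1 xy.2) ENNReal.toReal_nonneg
    _ = δ := by rw [← Finset.sum_mul, (toReal_mem_stdSimplex (prodLaw μX μY)).2, one_mul]

theorem IsErrorProtocol.exists_expected_loss_le [Fintype X] [Fintype Y] [Nonempty Z] {δ : ℝ}
    {f : X → Y → Z} (hP : P.IsErrorProtocol first k δ f) {μ : PMF (X × Y)} (hμ : IsProduct μ)
    {C : ℝ} (hC : 0 ≤ C) :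
    ∃ D : DetProtocol X Y Z, ∑ s, (μ s).toReal * D.loss C f first k s.1 s.2 ≤
      C * δ + 4 * P.infoCost first k μ + 15 * k := by
  obtain ⟨μX, μY, rfl⟩ := hμ.exists_eq_prodLaw
  obtain ⟨D, hD⟩ := exists_expected_loss_le_mutualInfo C f P.det first k Prod.fst Prod.fst
    (prodLaw μX P.coinA) (prodLaw μY P.coinB)
  have hmarginal : (prodLaw (prodLaw μX P.coinA) (prodLaw μY P.coinB)).map
      (fun s => (s.1.1, s.2.1)) = prodLaw μX μY := by
    simp only [prodLaw, PMF.map, PMF.bind_bind, PMF.pure_bind, Function.comp_def,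
      PMF.bind_const]
  refine ⟨D, ?_⟩
  have hloss := sum_map_mul (prodLaw (prodLaw μX P.coinA) (prodLaw μY P.coinB))
    (fun s => (s.1.1, s.2.1)) fun s => D.loss C f first k s.1 s.2
  rw [hmarginal] at hloss
  rw [hloss, infoCost, jointLaw_prodLaw]
  have herror := mul_le_mul_of_nonneg_left (hP.sum_mul_errorIndicator_le μX μY) hC
  linarith

end PrivateCoinProtocol

end PrivateCoins

section Truncation

variable {X : Type u} {Y : Type v} {Z : Type w}

namespace DetProtocol

variable (D : DetProtocol X Y Z) (first : Player) (k : ℕ)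

theorem mul_errorIndicator_truncate_le_loss {C : ℝ} (hC : 0 ≤ C) (f : X → Y → Z) (x : X) (y : Y) :
    C * errorIndicator ((D.truncate ⌊C⌋₊).output first k x y) (f x y) ≤ D.loss C f first k x y := by
  have hnonneg (z z' : Z) : 0 ≤ errorIndicator z z' := by rw [errorIndicator]; split_ifs <;> simp
  have hle_one (z z' : Z) : errorIndicator z z' ≤ 1 := by rw [errorIndicator]; split_ifs <;> simp
  rcases le_or_gt (D.transcript first x y k).flatten.length ⌊C⌋₊ with hshort | hlong
  · rw [output_truncate hshort]
    exact le_add_of_nonneg_left (Nat.cast_nonneg _)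
  · exact (mul_le_of_le_one_right hC (hle_one _ _)).trans <|
      ((Nat.floor_lt hC).1 hlong).le.trans
        (le_add_of_nonneg_right (mul_nonneg hC (hnonneg _ _)))

variable [Fintype X] [Fintype Y]

theorem successProb_eq_one_sub (μ : PMF (X × Y)) (f : X → Y → Z) : D.successProb first k μ f =
    1 - ∑ s, (μ s).toReal * errorIndicator (D.output first k s.1 s.2) (f s.1 s.2) := by
  rw [eq_sub_iff_add_eq, successProb, ← Finset.sum_add_distrib, ← (toReal_mem_stdSimplex μ).2]
  refine Finset.sum_congr rfl fun s _ => ?_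
  by_cases h : D.output first k s.1 s.2 = f s.1 s.2 <;> simp [errorIndicator, h]

theorem cost_truncate_le (B : ℕ) : (D.truncate B).cost first k ≤ B :=
  Finset.sup_le fun s _ => D.length_transcript_truncate_le B first s.1 s.2 k

theorem mul_one_sub_successProb_truncate_le (μ : PMF (X × Y)) (f : X → Y → Z) {C : ℝ}
    (hC : 0 ≤ C) : C * (1 - (D.truncate ⌊C⌋₊).successProb first k μ f) ≤
      ∑ s, (μ s).toReal * D.loss C f first k s.1 s.2 := by
  rw [successProb_eq_one_sub, sub_sub_cancel, Finset.mul_sum]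
  refine Finset.sum_le_sum fun s _ => ?_
  rw [mul_left_comm]
  exact mul_le_mul_of_nonneg_left
    (D.mul_errorIndicator_truncate_le_loss first k hC f s.1 s.2) ENNReal.toReal_nonneg

end DetProtocol

variable [Fintype X] [Fintype Y]

theorem distComplexity_nonpos [Nonempty Z] (first : Player) (k : ℕ) (μ : PMF (X × Y)) {δ : ℝ}
    (hδ : 1 ≤ δ) (f : X → Y → Z) : distComplexity first k μ δ f ≤ 0 := by
  obtain ⟨z⟩ := ‹Nonempty Z›
  set D : DetProtocol X Y Z := .silent (fun _ => z) fun _ => z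
  have hcost : D.cost first k = 0 := Nat.le_zero.1 <| Finset.sup_le fun s _ => by
    rw [DetProtocol.flatten_transcript_silent, List.length_nil]
  have hsuccess : 0 ≤ D.successProb first k μ f := Finset.sum_nonneg fun s _ => by
    split_ifs
    exacts [ENNReal.toReal_nonneg, le_rfl]
  refine (iInf₂_le D (by linarith)).trans_eq ?_
  rw [hcost, Nat.cast_zero]

theorem PrivateCoinProtocol.IsErrorProtocol.distComplexity_le [Nonempty Z]
    {P : PrivateCoinProtocol X Y Z} {first : Player} {k : ℕ} {δ : ℝ} {f : X → Y → Z}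
    (hP : P.IsErrorProtocol first k δ f) {μ : PMF (X × Y)} (hμ : IsProduct μ) (hk : 0 < k)
    {η : ℝ} (hη : 0 < η) :
    distComplexity first k μ (δ + η) f ≤ ((4 * P.infoCost first k μ + 15 * k) / η : ℝ) := by
  set C : ℝ := (4 * P.infoCost first k μ + 15 * k) / η
  have hC : 0 < C := div_pos (add_pos_of_nonneg_of_pos
    (mul_nonneg zero_le_four (P.infoCost_nonneg first k hμ))
    (mul_pos (by norm_num) (Nat.cast_pos.2 hk))) hη
  obtain ⟨D, hD⟩ := hP.exists_expected_loss_le hμ hC.le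
  have hsuccess : C * (1 - (D.truncate ⌊C⌋₊).successProb first k μ f) ≤ C * (δ + η) := by
    have htrunc := D.mul_one_sub_successProb_truncate_le first k μ f hC.le
    have hCη : C * η = 4 * P.infoCost first k μ + 15 * k := div_mul_cancel₀ _ hη.ne'
    linarith
  refine (iInf₂_le (D.truncate ⌊C⌋₊) (by linarith [le_of_mul_le_mul_left hsuccess hC])).trans ?_
  have hcost : ((D.truncate ⌊C⌋₊).cost first k : ℝ) ≤ C :=
    (Nat.cast_le.2 (D.cost_truncate_le first k _)).trans (Nat.floor_le hC.le)
  exact_mod_cast hcost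

end Truncation

theorem sq_div_mul_budget_le {I k ε : ℝ} (hI : 0 ≤ I) (hk : 1 ≤ k) (hε : 0 < ε)
    (hε_half : ε ≤ 1 / 2) : ε ^ 2 / (2 * k) * ((4 * I + 15 * k) / (2 * ε)) ≤ I + 2 := by
  have : 0 < k := one_pos.trans_le hk
  calc ε ^ 2 / (2 * k) * ((4 * I + 15 * k) / (2 * ε)) = ε * (I / k + 15 / 4) := by
        field_simp
        ring
    _ ≤ 1 / 2 * (I + 15 / 4) := mul_le_mul hε_half (add_le_add_left (div_le_self hI hk) _)
        (by positivity) one_half_pos.le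
    _ ≤ I + 2 := by linarith

end CommComplexity

open CommComplexity in
theorem mainTheorem3 {X Y Z : Type*} [Fintype X] [Fintype Y] (f : X → Y → Z)
    (μ : PMF (X × Y)) (hμ : IsProduct μ) (first : Player) (k : ℕ) (hk : 1 ≤ k)
    (δ ε : ℝ) (hδ : 0 < δ) (hε : 0 < ε) :
    ((ε ^ 2 / (2 * (k : ℝ)) : ℝ) : EReal) * distComplexity first k μ (δ + 2 * ε) f - 2
      ≤ infoComplexity first k μ δ f := by
  refine le_iInf₂ fun P hP => ?_
  obtain ⟨s, -⟩ := μ.support_nonempty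
  have : Nonempty Z := ⟨f s.1 s.2⟩
  have hI := P.infoCost_nonneg first k hμ
  have hcoef : (0 : EReal) ≤ (ε ^ 2 / (2 * k) : ℝ) := EReal.coe_nonneg.2 (by positivity)
  suffices ∃ c : ℝ, distComplexity first k μ (δ + 2 * ε) f ≤ c ∧
      ε ^ 2 / (2 * k) * c - 2 ≤ P.infoCost first k μ by
    obtain ⟨c, hdist, hc⟩ := this
    refine (EReal.sub_le_sub (mul_le_mul_of_nonneg_left hdist hcoef) le_rfl).trans ?_
    exact EReal.coe_le_coe_iff.2 hc
  rcases le_or_gt ε (1 / 2) with hε_half | hε_half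
  · exact ⟨_, hP.distComplexity_le hμ hk (mul_pos two_pos hε),
      sub_le_iff_le_add.2 (sq_div_mul_budget_le hI (Nat.one_le_cast.2 hk) hε hε_half)⟩
  · refine ⟨0, distComplexity_nonpos first k μ (by linarith) f, ?_⟩
    rw [mul_zero]
    linarith
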